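/- **Setting.** Let $\gamma$ be a random variable with values in $[0,\infty]$ on a probability space $(\Omega,\mathscr F,\mathsf P)$ with $\mathsf P(\gamma>0)>0$. Put $G(t)=\mathsf P(\gamma\le t)$ and $\overline G(t)=1-G(t)$ for $t\in[0,\infty)$, $t_G=\sup\{t\in[0,\infty):G(t)<1\}$ and $\mathcal T=\{t\in[0,\infty):\mathsf P(\gamma\ge t)>0\}$; the measure $dG$ on $[0,\infty)$ has mass $G(0)$ at $0$. Case A means $\mathsf P(\gamma=t_G<\infty)=0$ and Case B means $\mathsf P(\gamma=t_G<\infty)>0$. The single jump filtration is $(\mathscr F_t)_{t\ge0}$, where $\mathscr F_t$ consists of those $A\in\mathscr F$ for which $A\cap\{t<\gamma\}$ is either $\varnothing$ or $\{t<\gamma\}$. Martingale notions refer to this filtration (no completion), processes are adapted with almost all paths càdlàg, and a local martingale is a process $M$ for which there are stopping times $T_n\uparrow\infty$ a.s. such that every stopped process $M^{T_n}$ is a uniformly integrable martingale. Let $L^1_{\rm loc}(dG)$ be the set of Borel functions $z$ on $\mathcal T$ with $\int_{[0,t]}|z|\,dG<\infty$ for all $t\in\mathcal T$. For $F\colon[0,t_G)\to\mathbb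 R$ write $F\overset{\rm loc}{\ll}G$ and $\frac{dF}{dG}=z$ if $z\in L^1_{\rm loc}(dG)$ and $F(t)=F(0)+\int_{(0,t]}z\,dG$ for all $t<t_G$ (the value $z(0)$ is irrelevant). A pair $(F,H)$ satisfies Condition M if $F\overset{\rm loc}{\ll}G$, $H\in L^1_{\rm loc}(dG)$, $F(t)\overline G(t)+\int_{(0,t]}H\,dG=F(0)\overline G(0)$ for all $t<t_G$ and, in Case B, additionally $\lim_{t\uparrow t_G}F(t)=H(t_G)$. **Types.** Let $M_\infty=\lim_{t\to\infty}M_t$. Let $\mathrm{Var}(M)_\infty$ be the total variation of $M$ over $[0,\infty)$, including $|M_0|$. A local martingale $M$ has * type 1 if with positive probability $M_\infty$ does not exist, or if it exists a.s. but $\mathsf E|M_\infty|=\infty$; * type 2a (resp. 2b) if $M$ is a closed supermartingale (resp. submartingale), i.e. $(M_t)_{0\le t\le\infty}$ is a supermartingale (resp. submartingale), in particular $\mathsf E|M_\infty|<\infty$, and $\mathsf E M_\infty<\mathsf E M_0$ (resp. $\mathsf E M_\infty>\mathsf E M_0$); * type 3 if $M$ is a uniformly integrable martingale and $\mathsf E\sup_t|M_t|=\infty$;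 * type 4 if $\mathsf E\,\mathrm{Var}(M)_\infty<\infty$. **Theorem.** Let $M$ be a local martingale that is indistinguishable from $$F(t)\mathbf 1_{\{t<\gamma\}}+(H(\gamma)+L')\mathbf 1_{\{t\ge\gamma\}},\qquad t\in[0,\infty),$$ where $(F,H)$ satisfies Condition M and $L'$ is a random variable with $\mathsf E(|L'|\mathbf 1_{\{\gamma\le t\}})<\infty$ for all $t\in\mathcal T$ and $\mathsf E[L'\mid\gamma]=0$ (generalized conditional expectation, that is, $\mathsf E[|L'|\mid\gamma]<\infty$ and $\mathsf E[L'^+\mid\gamma]=\mathsf E[L'^-\mid\gamma]$ a.s.). In Case B, $M$ has type 4. In Case A all types are possible: for each of the types 1, 2a, 2b, 3, 4 there are a probability space, a $\gamma$ in Case A and such an $M$ of that type. Moreover, in Case A: (i) $M$ has type 1 if and only if $\mathsf E(|L'|\mathbf 1_{\{\gamma<\infty\}})=\infty$ or $\int_{[0,t_G)}|H|\,dG=\infty$. (ii) If $\mathsf P(\gamma=\infty)>0$, $\mathsf E(|L'|\mathbf 1_{\{\gamma<\infty\}})<\infty$ and $\int_{[0,\infty)}|H|\,dG<\infty$, then $M$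 has type 4. (iii) If $\mathsf P(\gamma=\infty)=0$, $\mathsf E|L'|<\infty$ and $\int_{[0,t_G)}|H|\,dG<\infty$, then the limit $\ell=\lim_{t\uparrow t_G}F(t)\overline G(t)$ exists in $\mathbb R$, and * $M$ has type 2a (resp. 2b) if and only if $\ell>0$ (resp. $\ell<0$); * $M$ has type 3 if and only if $\ell=0$ and $\int_{[0,t_G)}\overline G\,\bigl|\frac{dF}{dG}\bigr|\,dG=\infty$; * $M$ has type 4 if and only if $\int_{[0,t_G)}\overline G\,\bigl|\frac{dF}{dG}\bigr|\,dG<\infty$. -/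

import Mathlib

open Set Filter Topology MeasureTheory ProbabilityTheory
open scoped NNReal ENNReal

noncomputable section

namespace SingleJump

/-! ### Objects attached to a law `ν` on `[0, ∞]`: the law of the jump time -/

/-- The distribution function `G(t) = ν([0, t])`, `t ∈ [0, ∞)`. -/
def cdfG (ν : Measure ℝ≥0∞) (t : ℝ≥0) : ℝ := ν.real (Iic (t : ℝ≥0∞))

/-- The tail `1 - G(t)`. -/
def tailG (ν : Measure ℝ≥0∞) (t : ℝ≥0) : ℝ := 1 - cdfG ν t

/-- The right endpoint `t_G = sup {t ∈ [0, ∞) : G(t) < 1}`, an element of `[0, ∞]`. -/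
def endpoint (ν : Measure ℝ≥0∞) : ℝ≥0∞ :=
  sSup ((fun t : ℝ≥0 => (t : ℝ≥0∞)) '' {t | cdfG ν t < 1})

/-- The set of times `t ∈ [0, ∞)` such that `ν([t, ∞]) > 0`. -/
def timeSet (ν : Measure ℝ≥0∞) : Set ℝ≥0 := {t | 0 < ν (Ici (t : ℝ≥0∞))}

/-- The interval `[0, t_G)`. -/
def beforeEnd (ν : Measure ℝ≥0∞) : Set ℝ≥0 := {t | (t : ℝ≥0∞) < endpoint ν}

/-- The Lebesgue–Stieltjes measure `dG` on `[0, ∞)` (with mass `G(0)` at `0`), that is,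
the restriction of `ν` to `[0, ∞)`. -/
def dG (ν : Measure ℝ≥0∞) : Measure ℝ≥0 := ν.comap (fun t : ℝ≥0 => (t : ℝ≥0∞))

/-- The filter of `t → t_G`, `t < t_G`, on `[0, ∞)` (`t_G` may be finite or infinite). -/
def toEnd (ν : Measure ℝ≥0∞) : Filter ℝ≥0 :=
  comap (fun t : ℝ≥0 => (t : ℝ≥0∞)) (𝓝[<] (endpoint ν))

/-- Case A: there is no atom at a finite right endpoint. -/
def CaseA (ν : Measure ℝ≥0∞) : Prop := ν {x | x = endpoint ν ∧ x < ∞} = 0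

/-- Case B: there is an atom at a finite right endpoint. -/
def CaseB (ν : Measure ℝ≥0∞) : Prop := 0 < ν {x | x = endpoint ν ∧ x < ∞}

/-- `z` is a Borel function on the set `timeSet ν` which is `dG`-integrable over `[0, t]` for every
`t` in this set. Only the values of `z` on `timeSet ν` matter. -/
def MemL1loc (ν : Measure ℝ≥0∞) (z : ℝ≥0 → ℝ) : Prop :=
  Measurable (fun t : timeSet ν => z t) ∧ ∀ t ∈ timeSet ν, IntegrableOn z (Iic t) (dG ν)

/-- `z` is a version of the derivative `dF/dG`: it belongs to `L¹_loc(dG)` and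
`F(t) = F(0) + ∫_{(0,t]} z dG` for `t < t_G`. -/
def IsDensity (ν : Measure ℝ≥0∞) (F z : ℝ≥0 → ℝ) : Prop :=
  MemL1loc ν z ∧ ∀ t ∈ beforeEnd ν, F t = F 0 + ∫ s in Ioc 0 t, z s ∂(dG ν)

/-- Condition M for a pair `(F, H)`. Only the values of `F` on `[0, t_G)` and of `H` on
`timeSet ν` matter. -/
structure ConditionM (ν : Measure ℝ≥0∞) (F H : ℝ≥0 → ℝ) : Prop where
  absCont : ∃ z, IsDensity ν F z
  memL1loc : MemL1loc ν H
  main : ∀ t ∈ beforeEnd ν, F t * tailG ν t + ∫ s in Ioc 0 t, H s ∂(dG ν) = F 0 * tailG ν 0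
  mainB : CaseB ν → Tendsto F (toEnd ν) (𝓝 (H (endpoint ν).toNNReal))

/-! ### The single jump filtration and local martingales -/

variable {Ω : Type*} [mΩ : MeasurableSpace Ω]

/-- The single jump filtration generated by `γ`: `A` belongs to its `t`-th `σ`-field iff `A` is
measurable and `A ∩ {t < γ}` is either empty or the whole `{t < γ}`. -/
def singleJumpFiltration (γ : Ω → ℝ≥0∞) : Filtration ℝ≥0 mΩ where
  seq t :=
    { MeasurableSet' := fun A => MeasurableSet A ∧
        (A ∩ {ω | (t : ℝ≥0∞) < γ ω} = ∅ ∨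
          A ∩ {ω | (t : ℝ≥0∞) < γ ω} = {ω | (t : ℝ≥0∞) < γ ω})
      measurableSet_empty := ⟨MeasurableSet.empty, Or.inl (by simp)⟩
      measurableSet_compl := by
        rintro A ⟨hA, h | h⟩
        · refine ⟨hA.compl, Or.inr ?_⟩
          rw [inter_eq_right]
          intro ω hω hωA
          have : ω ∈ A ∩ {ω | (t : ℝ≥0∞) < γ ω} := ⟨hωA, hω⟩
          rw [h] at this
          exact this
        · refine ⟨hA.compl, Or.inl ?_⟩
          rw [inter_eq_right] at h
          ext ω
          simp only [mem_inter_iff, mem_compl_iff, mem_empty_iff_false, iff_false, not_and]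
          exact fun h1 h2 => h1 (h h2)
      measurableSet_iUnion := by
        intro A hA
        refine ⟨MeasurableSet.iUnion fun i => (hA i).1, ?_⟩
        by_cases h : ∃ i, A i ∩ {ω | (t : ℝ≥0∞) < γ ω} = {ω | (t : ℝ≥0∞) < γ ω}
        · obtain ⟨i, hi⟩ := h
          right
          rw [inter_eq_right] at hi ⊢
          exact hi.trans (subset_iUnion A i)
        · left
          push Not at h
          rw [iUnion_inter]
          exact iUnion_eq_empty.2 fun i => (hA i).2.resolve_right (h i) }
  mono' := by
    rintro s t hst A ⟨hA, h⟩
    refine ⟨hA, ?_⟩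
    have hsub : {ω | (t : ℝ≥0∞) < γ ω} ⊆ {ω | (s : ℝ≥0∞) < γ ω} := fun ω hω =>
      lt_of_le_of_lt (ENNReal.coe_le_coe.2 hst) hω
    rcases h with h | h
    · left
      exact subset_eq_empty (inter_subset_inter_right A hsub) h
    · right
      rw [inter_eq_right] at h ⊢
      exact hsub.trans h
  le' := fun _ _ hA => hA.1

/-- Almost all paths are right-continuous and have finite left-hand limits on `(0, ∞)`. -/
def AECadlag (P : Measure Ω) (M : ℝ≥0 → Ω → ℝ) : Prop :=
  ∀ᵐ ω ∂P, ∀ t : ℝ≥0, ContinuousWithinAt (fun s => M s ω) (Ici t) t ∧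
    ∃ l : ℝ, Tendsto (fun s => M s ω) (𝓝[<] t) (𝓝 l)

/-- A uniformly integrable martingale. -/
def IsUIMartingale (𝓕 : Filtration ℝ≥0 mΩ) (P : Measure Ω) (M : ℝ≥0 → Ω → ℝ) : Prop :=
  Martingale M 𝓕 P ∧ UniformIntegrable M 1 P

/-- A local martingale: an adapted process with almost all paths càdlàg, such that there are
stopping times `T n`, a.s. increasing to `∞`, for which the stopped processes are uniformly
integrable martingales. -/
structure IsLocalMartingale (𝓕 : Filtration ℝ≥0 mΩ) (P : Measure Ω) (M : ℝ≥0 → Ω → ℝ) :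
    Prop where
  adapted : StronglyAdapted 𝓕 M
  cadlag : AECadlag P M
  localized : ∃ T : ℕ → Ω → WithTop ℝ≥0, IsLocalizingSequence 𝓕 T P ∧
    ∀ n, IsUIMartingale 𝓕 P (stoppedProcess M (T n))

/-! ### Global behaviour -/

/-- Almost all paths have a finite limit as `t → ∞`. -/
def HasLimit (P : Measure Ω) (M : ℝ≥0 → Ω → ℝ) : Prop :=
  ∀ᵐ ω ∂P, ∃ l : ℝ, Tendsto (fun t => M t ω) atTop (𝓝 l)

/-- The terminal value `M_∞ = lim_{t → ∞} M_t` (meaningful where the limit exists). -/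
def terminal (M : ℝ≥0 → Ω → ℝ) (ω : Ω) : ℝ := limUnder atTop (fun t => M t ω)

/-- A closed supermartingale: `(M_t)_{0 ≤ t ≤ ∞}` is a supermartingale, where `M_∞` is the a.s.
limit of `M`. -/
structure IsClosedSupermartingale (𝓕 : Filtration ℝ≥0 mΩ) (P : Measure Ω) (M : ℝ≥0 → Ω → ℝ) :
    Prop where
  supermartingale : Supermartingale M 𝓕 P
  hasLimit : HasLimit P M
  integrable : Integrable (terminal M) P
  closed : ∀ t, P[terminal M | 𝓕 t] ≤ᵐ[P] M t

/-- A closed submartingale: `(M_t)_{0 ≤ t ≤ ∞}` is a submartingale, where `M_∞` is the a.s.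
limit of `M`. -/
structure IsClosedSubmartingale (𝓕 : Filtration ℝ≥0 mΩ) (P : Measure Ω) (M : ℝ≥0 → Ω → ℝ) :
    Prop where
  submartingale : Submartingale M 𝓕 P
  hasLimit : HasLimit P M
  integrable : Integrable (terminal M) P
  closed : ∀ t, M t ≤ᵐ[P] P[terminal M | 𝓕 t]

/-- Total variation over `[0, ∞)` of a path, the initial value `|M_0|` being counted as the
variation at `0`. -/
def totalVar (M : ℝ≥0 → Ω → ℝ) (ω : Ω) : ℝ≥0∞ :=
  ‖M 0 ω‖ₑ + eVariationOn (fun t => M t ω) univ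

/-- Names of the types of global behaviour. -/
inductive GlobalType : Type
  | type1
  | type2a
  | type2b
  | type3
  | type4

/-- The local martingale `M` has the given type. -/
def HasType (𝓕 : Filtration ℝ≥0 mΩ) (P : Measure Ω) (M : ℝ≥0 → Ω → ℝ) : GlobalType → Prop
  | .type1 => ¬ HasLimit P M ∨ (HasLimit P M ∧ ∫⁻ ω, ‖terminal M ω‖ₑ ∂P = ∞)
  | .type2a => IsClosedSupermartingale 𝓕 P M ∧ ∫ ω, terminal M ω ∂P < ∫ ω, M 0 ω ∂P
  | .type2b => IsClosedSubmartingale 𝓕 P M ∧ ∫ ω, M 0 ω ∂P < ∫ ω, terminal M ω ∂P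
  | .type3 => IsUIMartingale 𝓕 P M ∧ ∫⁻ ω, (⨆ t, ‖M t ω‖ₑ) ∂P = ∞
  | .type4 => ∫⁻ ω, totalVar M ω ∂P < ∞

/-! ### The representation -/

/-- `E[X | γ] = 0` for a random variable `X` that need not be integrable: `E[|X| | γ] < ∞` a.s. and
`E[X⁺ | γ] = E[X⁻ | γ]` a.s. -/
def CondExpZero (P : Measure Ω) (γ : Ω → ℝ≥0∞) (X : Ω → ℝ) : Prop :=
  (∀ᵐ ω ∂P, condLExp (MeasurableSpace.comap γ inferInstance) P (fun ω' => ‖X ω'‖ₑ) ω < ∞) ∧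
  condLExp (MeasurableSpace.comap γ inferInstance) P (fun ω => ENNReal.ofReal (X ω)) =ᵐ[P]
    condLExp (MeasurableSpace.comap γ inferInstance) P (fun ω => ENNReal.ofReal (-X ω))

/-- `M` is a local martingale for the single jump filtration generated by `γ`, and, up to
indistinguishability, `M_t = F(t) 1_{t < γ} + (H(γ) + L') 1_{t ≥ γ}`, where `(F, H)` satisfies
Condition M, `E(|L'| 1_{γ ≤ t}) < ∞` for all `t ∈ timeSet` and `E[L' | γ] = 0`. -/
structure IsRepresentedLocalMartingale (P : Measure Ω) (γ : Ω → ℝ≥0∞) (F H : ℝ≥0 → ℝ)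
    (L' : Ω → ℝ) (M : ℝ≥0 → Ω → ℝ) : Prop where
  localMartingale : IsLocalMartingale (singleJumpFiltration γ) P M
  conditionM : ConditionM (P.map γ) F H
  measurable_L' : Measurable L'
  integrableOn_L' : ∀ t ∈ timeSet (P.map γ), IntegrableOn L' {ω | γ ω ≤ (t : ℝ≥0∞)} P
  condExpZero_L' : CondExpZero P γ L'
  representation : ∀ᵐ ω ∂P, ∀ t : ℝ≥0,
    M t ω = ({ω' | (t : ℝ≥0∞) < γ ω'}.indicator (fun _ => F t) ω) +
      {ω' | γ ω' ≤ (t : ℝ≥0∞)}.indicator (fun ω' => H (γ ω').toNNReal + L' ω') ω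

end SingleJump

end

set_option linter.unusedSectionVars false

namespace SingleJump

section

/-! ### The law of the jump time -/

/-! Almost every path follows the deterministic function F before γ and is frozen at X = H(γ) + L'
from γ on, so each global property reduces to integrals of F, H and L'. Write Ḡ for `tailG` and z
for dF/dG.

The analytic core is integration by parts in differential form: F(s-) = Ḡ(s) z(s) + H(s) for
dG-almost every s in (0, t_G) (`leftValue_ae_eq`). A path has variation at most a constant multiple
of |F(0)| + |X| 1_{γ<∞} + ∫_{u<γ} |z| dG, and Tonelli turns the mean of the last term into ∫ Ḡ|z|
dG. So type 4 holds once X is integrable on {γ < ∞} and ∫ Ḡ|z| dG is finite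
(`lintegral_totalVar_lt_top`). Conversely sup|M| dominates |F(γ-)| on {0 < γ < ∞}; if its mean is
finite, then F(s-) is dG-integrable, and the identity returns ∫ Ḡ|z| dG < ∞ when H is integrable. In
Case B, or when γ = ∞ has positive probability, Ḡ is bounded below on [0, t_G), so Condition M
bounds F and the criterion applies.

For type 1, M_∞ = X on {γ < ∞}, and E|H(γ)| ≤ E|X| there by conditional Jensen (`lintegral_H_le`).
Hence X is integrable on {γ < ∞} exactly when both H and L' are.

If γ is a.s. finite, Condition M becomes F(t)Ḡ(t) = l + E[X; t < γ] for t < t_G. Since {t < γ} is an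
atom of the σ-field at time t, and M_t = X off it, the sign of the defect l alone decides between
super-, sub- and uniformly integrable martingale, and E M_0 = E M_∞ + l.

For realizability γ is geometric and FḠ is a step function with arbitrary values u(n). Then ∫|H| dG
is the total variation of u and l is its limit, so each type is a choice of u. -/

lemma measurableEmbedding_coe : MeasurableEmbedding (fun t : ℝ≥0 => (t : ℝ≥0∞)) :=
  ENNReal.isOpenEmbedding_coe.measurableEmbedding

section Law

variable (ν : Measure ℝ≥0∞)

lemma dG_apply (s : Set ℝ≥0) : dG ν s = ν ((fun t : ℝ≥0 => (t : ℝ≥0∞)) '' s) :=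
  measurableEmbedding_coe.comap_apply _ _

lemma dG_eq_map : dG ν = (ν.restrict (Iio ∞)).map ENNReal.toNNReal := by
  have h1 : (dG ν).map (fun t : ℝ≥0 => (t : ℝ≥0∞)) = ν.restrict (Iio ∞) := by
    rw [dG, measurableEmbedding_coe.map_comap]
    congr 1
    ext x
    simp only [Set.mem_range, mem_Iio, lt_top_iff_ne_top]
    exact ⟨by rintro ⟨y, rfl⟩; simp, fun h => ⟨x.toNNReal, ENNReal.coe_toNNReal h⟩⟩
  rw [← h1, Measure.map_map ENNReal.measurable_toNNReal measurableEmbedding_coe.measurable]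
  have : ENNReal.toNNReal ∘ (fun t : ℝ≥0 => (t : ℝ≥0∞)) = id := by ext; simp
  rw [this, Measure.map_id]

variable [IsProbabilityMeasure ν]

instance : IsFiniteMeasure (dG ν) := by
  rw [dG_eq_map]; infer_instance

lemma tailG_eq (t : ℝ≥0) : tailG ν t = ν.real (Ioi (t : ℝ≥0∞)) := by
  rw [tailG, cdfG, ← compl_Iic, probReal_compl_eq_one_sub measurableSet_Iic]

lemma ofReal_tailG (t : ℝ≥0) : ENNReal.ofReal (tailG ν t) = ν (Ioi (t : ℝ≥0∞)) := by
  rw [tailG_eq, ofReal_measureReal]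

lemma tailG_nonneg (t : ℝ≥0) : 0 ≤ tailG ν t := by
  rw [tailG_eq]; positivity

lemma tailG_le_one (t : ℝ≥0) : tailG ν t ≤ 1 := by
  rw [tailG_eq]; exact measureReal_le_one

lemma tailG_antitone : Antitone (tailG ν) := by
  intro s t h
  rw [tailG_eq, tailG_eq]
  exact measureReal_mono (Ioi_subset_Ioi (by exact_mod_cast h))

lemma measurable_tailG : Measurable (tailG ν) := (tailG_antitone ν).measurable

/-- The reverse direction is right continuity of G: a positive tail at t persists at t + 1/(n+1) for
some n, so t lies strictly below the supremum. -/
lemma mem_beforeEnd_iff {t : ℝ≥0} : t ∈ beforeEnd ν ↔ 0 < tailG ν t := by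
  constructor
  · intro h
    obtain ⟨_, ⟨s, hs, rfl⟩, hts⟩ := lt_sSup_iff.1 (show (t : ℝ≥0∞) < endpoint ν from h)
    have h1 : tailG ν s ≤ tailG ν t := tailG_antitone ν (ENNReal.coe_le_coe.1 hts.le)
    have h2 : 0 < tailG ν s := by simp only [tailG]; linarith [show cdfG ν s < 1 from hs]
    linarith
  · intro h
    rw [tailG_eq] at h
    by_contra hc
    have hnull : ∀ n : ℕ, ν (Ioi ((t + 1 / (n + 1) : ℝ≥0) : ℝ≥0∞)) = 0 := by
      intro n
      by_contra h0
      apply hc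
      have hpos : (0 : ℝ≥0) < 1 / (n + 1) := by positivity
      refine lt_of_lt_of_le (b := ((t + 1 / (n + 1) : ℝ≥0) : ℝ≥0∞)) ?_
        (le_sSup ⟨t + 1 / (n + 1), ?_, rfl⟩)
      · exact_mod_cast lt_add_of_pos_right t hpos
      · have h2 : 0 < tailG ν (t + 1 / (n + 1)) := by
          rw [tailG_eq]
          exact (measureReal_nonneg).lt_of_ne'
            (by rw [Measure.real, ENNReal.toReal_ne_zero]; exact ⟨h0, measure_ne_top _ _⟩)
        simp only [tailG] at h2
        exact show cdfG ν _ < 1 by linarith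
    have hU : Ioi (t : ℝ≥0∞) ⊆ ⋃ n : ℕ, Ioi ((t + 1 / (n + 1) : ℝ≥0) : ℝ≥0∞) := by
      intro x hx
      obtain ⟨y, hty, hyx⟩ := ENNReal.lt_iff_exists_nnreal_btwn.1 hx
      have hty' : t < y := by exact_mod_cast hty
      obtain ⟨n, hn⟩ := exists_nat_one_div_lt (tsub_pos_of_lt hty')
      refine mem_iUnion.2 ⟨n, lt_trans ?_ hyx⟩
      exact_mod_cast lt_tsub_iff_left.1 hn
    have : ν (Ioi (t : ℝ≥0∞)) = 0 := measure_mono_null hU (measure_iUnion_null hnull)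
    rw [Measure.real, this] at h
    simp at h

lemma measurableSet_beforeEnd : MeasurableSet (beforeEnd ν) :=
  measurableSet_lt measurableEmbedding_coe.measurable measurable_const

lemma beforeEnd_subset_timeSet : beforeEnd ν ⊆ timeSet ν := by
  intro t ht
  rw [mem_beforeEnd_iff, ← ENNReal.ofReal_pos, ofReal_tailG] at ht
  exact ht.trans_le (measure_mono Ioi_subset_Ici_self)

lemma mem_beforeEnd_of_le {s t : ℝ≥0} (h : s ≤ t) (ht : t ∈ beforeEnd ν) : s ∈ beforeEnd ν :=
  lt_of_le_of_lt (ENNReal.coe_le_coe.2 h) (show (t : ℝ≥0∞) < endpoint ν from ht)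

lemma measure_Ioi_eq_zero {t : ℝ≥0} (ht : t ∉ beforeEnd ν) : ν (Ioi (t : ℝ≥0∞)) = 0 := by
  rw [mem_beforeEnd_iff, not_lt] at ht
  rw [← ofReal_tailG, ENNReal.ofReal_eq_zero]
  exact ht

lemma ae_le_endpoint : ∀ᵐ x ∂ν, x ≤ endpoint ν := by
  by_cases h : endpoint ν = ∞
  · simp [h]
  · have h1 : (endpoint ν).toNNReal ∉ beforeEnd ν := by
      simp [beforeEnd, ENNReal.coe_toNNReal h]
    have := measure_Ioi_eq_zero ν h1
    rw [ENNReal.coe_toNNReal h] at this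
    rw [ae_iff]
    simpa [Ioi] using this

lemma ae_lt_endpoint (hA : CaseA ν) : ∀ᵐ x ∂ν, x < ∞ → x < endpoint ν := by
  have h2 : ∀ᵐ x ∂ν, ¬ (x = endpoint ν ∧ x < ∞) := by
    rw [ae_iff]; simpa only [CaseA, not_not] using hA
  filter_upwards [ae_le_endpoint ν, h2] with x hx hx2 hx3
  exact lt_of_le_of_ne hx fun h => hx2 ⟨h, hx3⟩

lemma ae_dG_mem_beforeEnd (hA : CaseA ν) : ∀ᵐ s ∂(dG ν), s ∈ beforeEnd ν := by
  rw [dG_eq_map]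
  refine (ae_map_iff ENNReal.measurable_toNNReal.aemeasurable (measurableSet_beforeEnd ν)).2 ?_
  rw [ae_restrict_iff' measurableSet_Iio]
  filter_upwards [ae_lt_endpoint ν hA] with x hx hx2
  simpa [beforeEnd, ENNReal.coe_toNNReal hx2.ne] using hx hx2

/-- Without an atom at a finite t_G, dG does not charge the complement of [0, t_G), so integrals
over [0, t_G) are integrals over all finite times. -/
lemma restrict_beforeEnd (hA : CaseA ν) : (dG ν).restrict (beforeEnd ν) = dG ν :=
  Measure.restrict_eq_self_of_ae_mem (ae_dG_mem_beforeEnd ν hA)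

lemma dG_real_Ioc {s t : ℝ≥0} (h : s ≤ t) :
    (dG ν).real (Ioc s t) = tailG ν s - tailG ν t := by
  have h1 : (fun t : ℝ≥0 => (t : ℝ≥0∞)) '' Ioc s t = Ioi (s : ℝ≥0∞) \ Ioi (t : ℝ≥0∞) := by
    rw [Ioi_sdiff_Ioi]
    ext x
    constructor
    · rintro ⟨y, ⟨h1, h2⟩, rfl⟩
      exact ⟨ENNReal.coe_lt_coe.2 h1, ENNReal.coe_le_coe.2 h2⟩
    · rintro ⟨h1, h2⟩
      lift x to ℝ≥0 using (h2.trans_lt ENNReal.coe_lt_top).ne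
      exact ⟨x, ⟨ENNReal.coe_lt_coe.1 h1, ENNReal.coe_le_coe.1 h2⟩, rfl⟩
  rw [tailG_eq, tailG_eq, Measure.real, dG_apply, h1, ← Measure.real,
    measureReal_sdiff (Ioi_subset_Ioi (by exact_mod_cast h)) measurableSet_Ioi]

variable {ν}

lemma endpoint_pos (h0 : 0 < ν (Ioi 0)) : 0 < endpoint ν := by
  have : (0 : ℝ≥0) ∈ beforeEnd ν := by
    rw [mem_beforeEnd_iff, ← ENNReal.ofReal_pos, ofReal_tailG]
    simpa using h0
  simpa [beforeEnd] using this

/-- A countable exhaustion of [0, t_G) by intervals [0, t_n] turns local integrability into global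
measurability and almost-everywhere statements. -/
lemma exists_seq_beforeEnd (h0 : 0 < ν (Ioi 0)) : ∃ t : ℕ → ℝ≥0, StrictMono t ∧
    (∀ n, t n ∈ beforeEnd ν) ∧ ∀ s ∈ beforeEnd ν, ∃ n, s ≤ t n := by
  obtain ⟨u, hu, hmem, hlim⟩ := exists_seq_strictMono_tendsto' (endpoint_pos h0)
  have hne : ∀ n, u n ≠ ∞ := fun n => ((hmem n).2.trans_le le_top).ne
  refine ⟨fun n => (u n).toNNReal, fun m n h => ?_, fun n => ?_, ?_⟩
  · exact (ENNReal.toNNReal_lt_toNNReal (hne m) (hne n)).2 (hu h)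
  · simpa [beforeEnd, ENNReal.coe_toNNReal (hne n)] using (hmem n).2
  · intro s hs
    obtain ⟨n, hn⟩ := (hlim.eventually (lt_mem_nhds hs)).exists
    refine ⟨n, ?_⟩
    rw [← ENNReal.coe_le_coe, ENNReal.coe_toNNReal (hne n)]
    exact hn.le

lemma eventually_toEnd_mem : ∀ᶠ t in toEnd ν, t ∈ beforeEnd ν :=
  (eventually_comap.2 (eventually_nhdsWithin_of_forall fun _ hx a ha => by
    simpa [beforeEnd, ha] using hx))

lemma eventually_toEnd_ge {s : ℝ≥0} (hs : s ∈ beforeEnd ν) : ∀ᶠ t in toEnd ν, s ≤ t := by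
  have : ∀ᶠ x in 𝓝[<] (endpoint ν), (s : ℝ≥0∞) < x :=
    mem_nhdsWithin_of_mem_nhds (lt_mem_nhds hs)
  refine eventually_comap.2 (this.mono fun x hx a ha => ?_)
  rw [← ha] at hx
  exact_mod_cast hx.le

/-- Dominated convergence along t ↑ t_G requires a countably generated filter. -/
instance : (toEnd ν).IsCountablyGenerated := by
  rw [toEnd]; infer_instance

end Law

/-! ### Transfer between dG and P through γ -/

section Random

variable {Ω : Type*} [MeasurableSpace Ω] {P : Measure Ω} {γ : Ω → ℝ≥0∞}

lemma dG_map (hγ : Measurable γ) :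
    dG (P.map γ) = (P.restrict {ω | γ ω < ∞}).map (fun ω => (γ ω).toNNReal) := by
  rw [dG_eq_map, Measure.restrict_map hγ measurableSet_Iio,
    Measure.map_map ENNReal.measurable_toNNReal hγ]
  rfl

lemma quasiMeasurePreserving (hγ : Measurable γ) :
    Measure.QuasiMeasurePreserving (fun ω => (γ ω).toNNReal) (P.restrict {ω | γ ω < ∞})
      (dG (P.map γ)) :=
  ⟨hγ.ennreal_toNNReal, (dG_map hγ).symm.absolutelyContinuous⟩

lemma lintegral_dG_map (hγ : Measurable γ) {f : ℝ≥0 → ℝ≥0∞} (hf : AEMeasurable f (dG (P.map γ))) :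
    ∫⁻ s, f s ∂(dG (P.map γ)) = ∫⁻ ω in {ω | γ ω < ∞}, f (γ ω).toNNReal ∂P := by
  rw [dG_map hγ] at hf ⊢
  exact lintegral_map' hf hγ.ennreal_toNNReal.aemeasurable

lemma preimage_finite (hγ : Measurable γ) (s : Set ℝ≥0) (hs : MeasurableSet s) :
    (P.restrict {ω | γ ω < ∞}).restrict ((fun ω => (γ ω).toNNReal) ⁻¹' s) =
      P.restrict {ω | γ ω < ∞ ∧ (γ ω).toNNReal ∈ s} := by
  rw [Measure.restrict_restrict (hγ.ennreal_toNNReal hs)]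
  congr 1
  ext ω
  simp [and_comm]

lemma setIntegral_dG_map (hγ : Measurable γ) {f : ℝ≥0 → ℝ} {s : Set ℝ≥0} (hs : MeasurableSet s)
    (hf : AEStronglyMeasurable f (dG (P.map γ))) :
    ∫ x in s, f x ∂(dG (P.map γ)) =
      ∫ ω in {ω | γ ω < ∞ ∧ (γ ω).toNNReal ∈ s}, f (γ ω).toNNReal ∂P := by
  rw [dG_map hγ] at hf ⊢
  rw [setIntegral_map hs hf hγ.ennreal_toNNReal.aemeasurable, preimage_finite hγ s hs]

lemma integrableOn_dG_map (hγ : Measurable γ) {f : ℝ≥0 → ℝ} {s : Set ℝ≥0} (hs : MeasurableSet s)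
    (hf : AEStronglyMeasurable f (dG (P.map γ))) :
    IntegrableOn f s (dG (P.map γ)) ↔
      IntegrableOn (fun ω => f (γ ω).toNNReal) {ω | γ ω < ∞ ∧ (γ ω).toNNReal ∈ s} P := by
  rw [dG_map hγ] at hf ⊢
  rw [IntegrableOn, Measure.restrict_map hγ.ennreal_toNNReal hs,
    integrable_map_measure _ hγ.ennreal_toNNReal.aemeasurable, preimage_finite hγ s hs]
  · rfl
  · rw [← Measure.restrict_map hγ.ennreal_toNNReal hs]
    exact hf.restrict

end Random

end

section

/-! ### Analysis of Condition M -/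

/-- An integrable function whose integrals over all half-lines vanish is null. -/
lemma ae_eq_zero_of_forall_setIntegral_Iic {μ : Measure ℝ≥0} [IsFiniteMeasure μ] {g : ℝ≥0 → ℝ}
    (hg : Integrable g μ) (h : ∀ t, ∫ s in Iic t, g s ∂μ = 0) : g =ᵐ[μ] 0 := by
  have hm := hg.aestronglyMeasurable.aemeasurable
  have hfin : ∀ {f : ℝ≥0 → ℝ} {μ : Measure ℝ≥0}, Integrable f μ →
      ∫⁻ s, ENNReal.ofReal (f s) ∂μ ≠ ∞ := fun hf =>
    ((lintegral_mono fun s => Real.ofReal_le_enorm _).trans_lt hf.2).ne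
  have h1 : ∫⁻ s, ENNReal.ofReal (g s) ∂μ ≠ ∞ := hfin hg
  have h2 : ∫⁻ s, ENNReal.ofReal (-g s) ∂μ ≠ ∞ := hfin hg.neg
  have : IsFiniteMeasure (μ.withDensity fun s => ENNReal.ofReal (g s)) :=
    isFiniteMeasure_withDensity h1
  -- The positive and negative parts of g are densities of finite measures that agree on all
  -- half-lines, hence coincide.
  have key : (μ.withDensity fun s => ENNReal.ofReal (g s)) =
      μ.withDensity fun s => ENNReal.ofReal (-g s) := by
    refine Measure.ext_of_Iic _ _ fun t => ?_
    rw [withDensity_apply _ measurableSet_Iic, withDensity_apply _ measurableSet_Iic]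
    have h3 := h t
    rw [integral_eq_lintegral_pos_part_sub_lintegral_neg_part hg.integrableOn, sub_eq_zero,
      ENNReal.toReal_eq_toReal_iff' (hfin hg.integrableOn)
        (hfin (f := fun s => -g s) hg.neg.integrableOn)] at h3
    exact h3
  have := (withDensity_eq_iff hm.ennreal_ofReal hm.neg.ennreal_ofReal h1).1 key
  filter_upwards [this] with s hs
  simp only [Pi.neg_apply] at hs
  rcases le_total 0 (g s) with h0 | h0
  · have : ENNReal.ofReal (-g s) = 0 := ENNReal.ofReal_eq_zero.2 (by linarith)
    rw [this, ENNReal.ofReal_eq_zero] at hs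
    simp only [Pi.zero_apply]; linarith
  · have : ENNReal.ofReal (g s) = 0 := ENNReal.ofReal_eq_zero.2 h0
    rw [this, eq_comm, ENNReal.ofReal_eq_zero] at hs
    simp only [Pi.zero_apply]; linarith

/-- The left limit `F(s-)`, expressed through the density `z` of `F`. -/
noncomputable def leftValue (ν : Measure ℝ≥0∞) (F z : ℝ≥0 → ℝ) (s : ℝ≥0) : ℝ :=
  F 0 + ∫ u in Ioo 0 s, z u ∂(dG ν)

variable {ν : Measure ℝ≥0∞} [IsProbabilityMeasure ν] {F H z : ℝ≥0 → ℝ}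

lemma beforeEnd_eq_iUnion {t : ℕ → ℝ≥0} (h1 : ∀ n, t n ∈ beforeEnd ν)
    (h2 : ∀ s ∈ beforeEnd ν, ∃ n, s ≤ t n) : beforeEnd ν = ⋃ n, Iic (t n) := by
  ext s
  simp only [mem_iUnion, mem_Iic]
  exact ⟨h2 s, fun ⟨n, hn⟩ => mem_beforeEnd_of_le ν hn (h1 n)⟩

lemma MemL1loc.aestronglyMeasurable (hz : MemL1loc ν z) (h0 : 0 < ν (Ioi 0)) :
    AEStronglyMeasurable z ((dG ν).restrict (beforeEnd ν)) := by
  obtain ⟨t, -, h1, h2⟩ := exists_seq_beforeEnd h0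
  rw [beforeEnd_eq_iUnion h1 h2, aestronglyMeasurable_iUnion_iff]
  exact fun n => (hz.2 _ (beforeEnd_subset_timeSet ν (h1 n))).aestronglyMeasurable

lemma MemL1loc.integrableOn_Iic (hz : MemL1loc ν z) {t : ℝ≥0} (ht : t ∈ beforeEnd ν) :
    IntegrableOn z (Iic t) (dG ν) := hz.2 t (beforeEnd_subset_timeSet ν ht)

/-- Dominated convergence with majorant |z| on [0, s]: as t ↑ s the indicators of (0, t] tend to
that of (0, s). -/
lemma IsDensity.tendsto_leftValue (hF : IsDensity ν F z) {s : ℝ≥0} (hs : s ∈ beforeEnd ν) :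
    Tendsto F (𝓝[<] s) (𝓝 (leftValue ν F z s)) := by
  have hint := hF.1.integrableOn_Iic hs
  have heq : ∀ᶠ t in 𝓝[<] s, F 0 + ∫ u in Iic s, (Ioc 0 t).indicator z u ∂(dG ν) = F t := by
    filter_upwards [self_mem_nhdsWithin] with t ht
    rw [hF.2 t (mem_beforeEnd_of_le ν (le_of_lt ht) hs), setIntegral_indicator measurableSet_Ioc]
    congr 3
    ext u
    simp only [mem_inter_iff, mem_Iic, mem_Ioc]
    exact ⟨fun h => h.2, fun h => ⟨h.2.trans (le_of_lt ht), h⟩⟩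
  refine Tendsto.congr' heq (tendsto_const_nhds.add ?_)
  have h2 : ∫ u in Ioo 0 s, z u ∂(dG ν) = ∫ u in Iic s, (Ioo 0 s).indicator z u ∂(dG ν) := by
    rw [setIntegral_indicator measurableSet_Ioo]
    congr 2
    ext u
    simp only [mem_inter_iff, mem_Iic, mem_Ioo]
    exact ⟨fun h => ⟨h.2.le, h⟩, fun h => h.2⟩
  rw [h2]
  refine tendsto_integral_filter_of_dominated_convergence (fun u => ‖z u‖) ?_ ?_ hint.norm ?_
  · exact Eventually.of_forall fun t => hint.aestronglyMeasurable.indicator measurableSet_Ioc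
  · exact Eventually.of_forall fun t => Eventually.of_forall fun u => norm_indicator_le_norm_self _ _
  · refine Eventually.of_forall fun u => tendsto_const_nhds.congr' ?_
    rcases lt_or_ge u s with h | h
    · have h3 : ∀ᶠ t in 𝓝[<] s, u < t := mem_nhdsWithin_of_mem_nhds (lt_mem_nhds h)
      filter_upwards [h3] with t ht
      simp [indicator, h, ht.le]
    · filter_upwards [self_mem_nhdsWithin] with t ht
      have : ¬ u ≤ t := not_le.2 (lt_of_lt_of_le ht h)
      simp [indicator, this, not_lt.2 h]

/-- Fubini's theorem for the integral of `F(s-) - F(0)` with respect to `dG`. -/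
lemma integral_Ioo_swap {t : ℝ≥0} (hz : IntegrableOn z (Iic t) (dG ν)) :
    IntegrableOn (fun s => ∫ u in Ioo 0 s, z u ∂(dG ν)) (Ioc 0 t) (dG ν) ∧
    ∫ s in Ioc 0 t, (∫ u in Ioo 0 s, z u ∂(dG ν)) ∂(dG ν) =
      ∫ u in Ioc 0 t, (tailG ν u - tailG ν t) * z u ∂(dG ν) := by
  set μ := (dG ν).restrict (Ioc 0 t) with hμ
  have hz' : Integrable z μ := hz.mono_set (fun u hu => hu.2)
  have hf : Integrable (Function.uncurry fun s u : ℝ≥0 => (Iio s).indicator z u) (μ.prod μ) := by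
    have h1 : MeasurableSet {p : ℝ≥0 × ℝ≥0 | p.2 < p.1} :=
      measurableSet_lt measurable_snd measurable_fst
    refine ((hz'.comp_snd μ).indicator h1).congr (Eventually.of_forall fun p => ?_)
    simp [indicator, Function.uncurry]
  have h1 : (fun s => ∫ u, (Iio s).indicator z u ∂μ) =ᵐ[μ]
      fun s => ∫ u in Ioo 0 s, z u ∂(dG ν) := by
    filter_upwards [ae_restrict_mem measurableSet_Ioc] with s hs
    rw [integral_indicator measurableSet_Iio, hμ, Measure.restrict_restrict measurableSet_Iio]
    congr 2
    ext u
    simp only [mem_inter_iff, mem_Iio, mem_Ioc, mem_Ioo]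
    exact ⟨fun h => ⟨h.2.1, h.1⟩, fun h => ⟨h.2, h.1, h.2.le.trans hs.2⟩⟩
  have h2 : (fun u => ∫ s, (Iio s).indicator z u ∂μ) =ᵐ[μ]
      fun u => (tailG ν u - tailG ν t) * z u := by
    filter_upwards [ae_restrict_mem measurableSet_Ioc] with u hu
    have h3 : ∀ s : ℝ≥0, (Iio s).indicator z u = (Ioi u).indicator (fun _ => z u) s := by
      intro s; simp [indicator]
    simp_rw [h3]
    rw [integral_indicator measurableSet_Ioi, setIntegral_const, smul_eq_mul, Measure.real, hμ,
      Measure.restrict_apply measurableSet_Ioi, ← dG_real_Ioc ν hu.2, Measure.real]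
    congr 3
    ext s
    simp only [mem_inter_iff, mem_Ioi, mem_Ioc]
    exact ⟨fun h => ⟨h.1, h.2.2⟩, fun h => ⟨h.1, hu.1.trans h.1, h.2⟩⟩
  refine ⟨hf.integral_prod_left.congr h1, ?_⟩
  rw [← integral_congr_ae h1, ← integral_congr_ae h2]
  exact integral_integral_swap hf

/-- The equation of Condition M, that is, the content of `ConditionM.main`. -/
def MainEq (ν : Measure ℝ≥0∞) (F H : ℝ≥0 → ℝ) : Prop :=
  ∀ t ∈ beforeEnd ν, F t * tailG ν t + ∫ s in Ioc 0 t, H s ∂(dG ν) = F 0 * tailG ν 0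

lemma integrableOn_tailG_mul {t : ℝ≥0} (hz : IntegrableOn z (Iic t) (dG ν)) :
    IntegrableOn (fun s => tailG ν s * z s) (Iic t) (dG ν) := by
  refine Integrable.bdd_mul (c := 1) hz (measurable_tailG ν).aestronglyMeasurable ?_
  refine Eventually.of_forall fun s => ?_
  rw [Real.norm_eq_abs, abs_of_nonneg (tailG_nonneg ν s)]
  exact tailG_le_one ν s

/-- Inserting F(t) = F(0) + ∫ z into the equation of Condition M and exchanging the order of
integration shows that F(s-) - Ḡ(s)z(s) - H(s) has zero integral over every (0, t]; it is therefore
null. -/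
lemma tailG_mul_density_ae_Ioc (hF : IsDensity ν F z) (hH : MemL1loc ν H) (hM : MainEq ν F H)
    {T : ℝ≥0} (hT : T ∈ beforeEnd ν) :
    ∀ᵐ s ∂((dG ν).restrict (Ioc 0 T)), leftValue ν F z s = tailG ν s * z s + H s := by
  have hsub : ∀ t : ℝ≥0, Ioc 0 t ⊆ Iic t := fun t u hu => hu.2
  have main : ∀ t ∈ beforeEnd ν,
      IntegrableOn (fun s => leftValue ν F z s - (tailG ν s * z s + H s)) (Ioc 0 t) (dG ν) ∧
      ∫ s in Ioc 0 t, (leftValue ν F z s - (tailG ν s * z s + H s)) ∂(dG ν) = 0 := by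
    intro t ht
    have hzt := hF.1.integrableOn_Iic ht
    obtain ⟨i1, e1⟩ := integral_Ioo_swap hzt
    have i2 := (integrableOn_tailG_mul hzt).mono_set (hsub t)
    have i3 := (hH.integrableOn_Iic ht).mono_set (hsub t)
    have i4 : IntegrableOn (fun _ => F 0) (Ioc 0 t) (dG ν) := integrable_const _
    have i5 : IntegrableOn (leftValue ν F z) (Ioc 0 t) (dG ν) := i4.add i1
    refine ⟨i5.sub (i2.add i3), ?_⟩
    have e0 := integral_sub i5 (i2.add i3)
    have e0' := integral_add i2 i3
    simp only [Pi.add_apply] at e0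
    rw [e0, e0']
    have e5 : ∫ s in Ioc 0 t, leftValue ν F z s ∂(dG ν) = F 0 * (tailG ν 0 - tailG ν t) +
        ∫ s in Ioc 0 t, (∫ u in Ioo 0 s, z u ∂(dG ν)) ∂(dG ν) := by
      simp only [leftValue]
      rw [integral_add i4 i1, setIntegral_const, smul_eq_mul, dG_real_Ioc ν (zero_le), mul_comm]
    have e6 : ∫ u in Ioc 0 t, (tailG ν u - tailG ν t) * z u ∂(dG ν) =
        ∫ u in Ioc 0 t, tailG ν u * z u ∂(dG ν) - tailG ν t * ∫ u in Ioc 0 t, z u ∂(dG ν) := by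
      rw [← integral_const_mul, ← integral_sub i2 ((hzt.mono_set (hsub t)).const_mul _)]
      congr 1; ext u; ring
    rw [e5, e1, e6]
    have e7 := hM t ht
    have e8 := hF.2 t ht
    rw [e8] at e7
    linarith
  have := ae_eq_zero_of_forall_setIntegral_Iic (main T hT).1 (fun t => ?_)
  · filter_upwards [this] with s hs
    simpa [sub_eq_zero] using hs
  · rw [Measure.restrict_restrict measurableSet_Iic]
    have : Iic t ∩ Ioc 0 T = Ioc 0 (min t T) := by
      ext u; simp only [mem_inter_iff, mem_Iic, mem_Ioc, le_min_iff]; tauto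
    rw [this]
    exact (main _ (mem_beforeEnd_of_le ν (min_le_right _ _) hT)).2

/-- Integration by parts in differential form: `F(s-) = (1 - G(s)) z(s) + H(s)`. -/
lemma leftValue_ae_eq (h0 : 0 < ν (Ioi 0)) (hF : IsDensity ν F z) (hH : MemL1loc ν H)
    (hM : MainEq ν F H) :
    ∀ᵐ s ∂((dG ν).restrict (beforeEnd ν ∩ Ioi 0)), leftValue ν F z s = tailG ν s * z s + H s := by
  obtain ⟨t, -, h1, h2⟩ := exists_seq_beforeEnd h0
  rw [beforeEnd_eq_iUnion h1 h2, iUnion_inter, ae_restrict_iUnion_iff]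
  intro n
  have : Iic (t n) ∩ Ioi 0 = Ioc 0 (t n) := by
    ext u; simp only [mem_inter_iff, mem_Iic, mem_Ioi, mem_Ioc]; tauto
  rw [this]
  exact tailG_mul_density_ae_Ioc hF hH hM (h1 n)

/-- The integration by parts identity says nothing at 0, where dG may have an atom; a single point
contributes only a finite amount. -/
lemma lintegral_beforeEnd_lt_top {f : ℝ≥0 → ℝ≥0∞} (hf : f 0 ≠ ∞)
    (h : ∫⁻ s in beforeEnd ν ∩ Ioi 0, f s ∂(dG ν) < ∞) :
    ∫⁻ s in beforeEnd ν, f s ∂(dG ν) < ∞ := by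
  have h1 : beforeEnd ν ⊆ (beforeEnd ν ∩ Ioi 0) ∪ {0} := by
    intro s hs
    rcases eq_or_ne s 0 with h | h
    · exact Or.inr h
    · exact Or.inl ⟨hs, pos_iff_ne_zero.2 h⟩
  refine (lintegral_mono_set h1).trans_lt ((lintegral_union_le _ _ _).trans_lt ?_)
  refine ENNReal.add_lt_top.2 ⟨h, ?_⟩
  rw [lintegral_singleton]
  exact ENNReal.mul_lt_top hf.lt_top (measure_lt_top _ _)

/-- Since Ḡz = F(s-) - H almost everywhere, integrability of the left limits of F is all that has to
be added to that of H. -/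
lemma lintegral_tailG_lt_top (h0 : 0 < ν (Ioi 0)) (hF : IsDensity ν F z) (hH : MemL1loc ν H)
    (hM : MainEq ν F H) (hHi : ∫⁻ s in beforeEnd ν, ‖H s‖ₑ ∂(dG ν) < ∞)
    (hL : ∫⁻ s in beforeEnd ν ∩ Ioi 0, ‖leftValue ν F z s‖ₑ ∂(dG ν) < ∞) :
    ∫⁻ s in beforeEnd ν, ENNReal.ofReal (tailG ν s * |z s|) ∂(dG ν) < ∞ := by
  refine lintegral_beforeEnd_lt_top ENNReal.ofReal_ne_top ?_
  have hle : ∫⁻ s in beforeEnd ν ∩ Ioi 0, ENNReal.ofReal (tailG ν s * |z s|) ∂(dG ν) ≤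
      ∫⁻ s in beforeEnd ν ∩ Ioi 0, (‖leftValue ν F z s‖ₑ + ‖H s‖ₑ) ∂(dG ν) := by
    refine lintegral_mono_ae ?_
    filter_upwards [leftValue_ae_eq h0 hF hH hM] with s hs
    rw [← abs_of_nonneg (tailG_nonneg ν s), ← abs_mul, ← Real.enorm_eq_ofReal_abs]
    have : tailG ν s * z s = leftValue ν F z s - H s := by rw [hs]; ring
    rw [this]
    exact enorm_sub_le
  refine hle.trans_lt ?_
  rw [lintegral_add_right' _ (((hH.aestronglyMeasurable h0).mono_measure
    (Measure.restrict_mono_set _ inter_subset_left)).enorm)]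
  exact ENNReal.add_lt_top.2 ⟨hL, (lintegral_mono_set inter_subset_left).trans_lt hHi⟩

/-- Condition M expresses FḠ through ∫_{(0,t]} H dG, which converges by dominated convergence. The
limit is the defect l of part (iii). -/
lemma MainEq.tendsto (hM : MainEq ν F H)
    (hHi : IntegrableOn H (beforeEnd ν) (dG ν)) :
    Tendsto (fun t => F t * tailG ν t) (toEnd ν)
      (𝓝 (F 0 * tailG ν 0 - ∫ s in beforeEnd ν ∩ Ioi 0, H s ∂(dG ν))) := by
  have heq : ∀ᶠ t in toEnd ν, F 0 * tailG ν 0 -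
      ∫ s in beforeEnd ν, (Ioc 0 t).indicator H s ∂(dG ν) = F t * tailG ν t := by
    filter_upwards [eventually_toEnd_mem] with t ht
    rw [setIntegral_indicator measurableSet_Ioc]
    have : beforeEnd ν ∩ Ioc 0 t = Ioc 0 t :=
      inter_eq_right.2 fun s hs => mem_beforeEnd_of_le ν hs.2 ht
    rw [this, ← hM t ht]
    ring
  refine Tendsto.congr' heq (tendsto_const_nhds.sub ?_)
  rw [← setIntegral_indicator measurableSet_Ioi]
  refine tendsto_integral_filter_of_dominated_convergence (fun u => ‖H u‖) ?_ ?_ hHi.norm ?_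
  · exact Eventually.of_forall fun t => hHi.aestronglyMeasurable.indicator measurableSet_Ioc
  · exact Eventually.of_forall fun t => Eventually.of_forall fun u => norm_indicator_le_norm_self _ _
  · filter_upwards [ae_restrict_mem (measurableSet_beforeEnd ν)] with s hs
    refine tendsto_const_nhds.congr' ?_
    filter_upwards [eventually_toEnd_ge hs] with t ht
    simp [indicator, ht]

/-- If Ḡ ≥ c > 0, then c|F(t)| ≤ |F(t)|Ḡ(t) ≤ |F(0)| + ∫|H| dG, so F and its left limits are
bounded, hence integrable against the finite measure dG. This serves both Case B and P(γ = ∞) > 0.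
-/
lemma lintegral_tailG_lt_top_of_le_tailG (h0 : 0 < ν (Ioi 0)) (hF : IsDensity ν F z)
    (hH : MemL1loc ν H) (hM : MainEq ν F H) (hHi : ∫⁻ s in beforeEnd ν, ‖H s‖ₑ ∂(dG ν) < ∞)
    {c : ℝ} (hc : 0 < c) (htail : ∀ t ∈ beforeEnd ν, c ≤ tailG ν t) :
    ∫⁻ s in beforeEnd ν, ENNReal.ofReal (tailG ν s * |z s|) ∂(dG ν) < ∞ := by
  refine lintegral_tailG_lt_top h0 hF hH hM hHi ?_
  have hHi' : IntegrableOn H (beforeEnd ν) (dG ν) := ⟨hH.aestronglyMeasurable h0, hHi⟩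
  set K : ℝ := (|F 0| + ∫ s in beforeEnd ν, ‖H s‖ ∂(dG ν)) / c with hK
  have hbound : ∀ t ∈ beforeEnd ν, |F t| ≤ K := by
    intro t ht
    rw [hK, le_div_iff₀ hc]
    have h1 : F t * tailG ν t = F 0 * tailG ν 0 - ∫ s in Ioc 0 t, H s ∂(dG ν) := by
      rw [← hM t ht]; ring
    have h2 : |∫ s in Ioc 0 t, H s ∂(dG ν)| ≤ ∫ s in beforeEnd ν, ‖H s‖ ∂(dG ν) := by
      refine (norm_integral_le_integral_norm (μ := (dG ν).restrict (Ioc 0 t)) H).trans ?_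
      refine setIntegral_mono_set hHi'.norm (Eventually.of_forall fun s => norm_nonneg _) ?_
      exact LE.le.eventuallyLE fun s hs => mem_beforeEnd_of_le ν hs.2 ht
    have h3 : |F 0 * tailG ν 0| ≤ |F 0| := by
      rw [abs_mul, abs_of_nonneg (tailG_nonneg ν 0)]
      exact mul_le_of_le_one_right (abs_nonneg _) (tailG_le_one ν 0)
    calc |F t| * c ≤ |F t| * tailG ν t := mul_le_mul_of_nonneg_left (htail t ht) (abs_nonneg _)
      _ = |F t * tailG ν t| := by rw [abs_mul, abs_of_nonneg (tailG_nonneg ν t)]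
      _ ≤ |F 0 * tailG ν 0| + |∫ s in Ioc 0 t, H s ∂(dG ν)| := by rw [h1]; exact abs_sub _ _
      _ ≤ _ := by linarith
  have hleft : ∀ s ∈ beforeEnd ν ∩ Ioi 0, ‖leftValue ν F z s‖ₑ ≤ ENNReal.ofReal K := by
    rintro s ⟨hs, hs0⟩
    have : (𝓝[<] s).NeBot := nhdsLT_neBot_of_exists_lt ⟨0, hs0⟩
    rw [Real.enorm_eq_ofReal_abs]
    refine ENNReal.ofReal_le_ofReal (le_of_tendsto (hF.tendsto_leftValue hs).abs ?_)
    filter_upwards [self_mem_nhdsWithin] with t ht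
    exact hbound t (mem_beforeEnd_of_le ν (le_of_lt ht) hs)
  calc ∫⁻ s in beforeEnd ν ∩ Ioi 0, ‖leftValue ν F z s‖ₑ ∂(dG ν)
      ≤ ∫⁻ s in beforeEnd ν ∩ Ioi 0, ENNReal.ofReal K ∂(dG ν) :=
        setLIntegral_mono measurable_const hleft
    _ < ∞ := by
        rw [setLIntegral_const]
        exact ENNReal.mul_lt_top ENNReal.ofReal_lt_top (measure_lt_top _ _)

end

section

/-! ### Paths -/

/-- Telescoping along a partition: φ acts as a running account from which each increment of f is
paid. -/
lemma eVariationOn_univ_le {f : ℝ≥0 → ℝ} {φ : ℝ≥0 → ℝ≥0∞} {C : ℝ≥0∞}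
    (h : ∀ s t, s ≤ t → edist (f t) (f s) + φ s ≤ φ t) (hC : ∀ t, φ t ≤ C) :
    eVariationOn f univ ≤ C := by
  refine iSup_le fun p => ?_
  obtain ⟨n, u, hu, -⟩ := p
  have key : ∀ m : ℕ, ∑ i ∈ Finset.range m, edist (f (u (i + 1))) (f (u i)) + φ (u 0) ≤ φ (u m) := by
    intro m
    induction m with
    | zero => simp
    | succ m ih =>
      rw [Finset.sum_range_succ]
      calc _ = edist (f (u (m + 1))) (f (u m)) +
            (∑ i ∈ Finset.range m, edist (f (u (i + 1))) (f (u i)) + φ (u 0)) := by ring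
        _ ≤ edist (f (u (m + 1))) (f (u m)) + φ (u m) := by gcongr
        _ ≤ _ := h _ _ (hu (Nat.le_succ m))
  exact (le_self_add.trans (key n)).trans (hC _)

variable {ν : Measure ℝ≥0∞} {F z : ℝ≥0 → ℝ}

lemma IsDensity.enorm_sub_le [IsProbabilityMeasure ν] (hF : IsDensity ν F z) {s t : ℝ≥0}
    (hst : s ≤ t) (ht : t ∈ beforeEnd ν) :
    ‖F t - F s‖ₑ ≤ ∫⁻ u in Ioc s t, ‖z u‖ₑ ∂(dG ν) := by
  have hint := hF.1.integrableOn_Iic ht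
  have h1 : F t - F s = ∫ u in Ioc s t, z u ∂(dG ν) := by
    rw [hF.2 t ht, hF.2 s (mem_beforeEnd_of_le ν hst ht), ← Ioc_union_Ioc_eq_Ioc zero_le hst,
      setIntegral_union (Ioc_disjoint_Ioc_of_le le_rfl) measurableSet_Ioc
      (hint.mono_set fun u hu => hu.2.trans hst) (hint.mono_set fun u hu => hu.2)]
    ring
  rw [h1]
  exact enorm_integral_le_lintegral_enorm _

/-- A path that follows `F` before the time `g` and is constant afterwards. -/
lemma path_variation_le [IsProbabilityMeasure ν] (hF : IsDensity ν F z) {g : ℝ≥0∞}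
    (hg : g ≤ endpoint ν) {c : ℝ} {f : ℝ≥0 → ℝ}
    (hf : ∀ t : ℝ≥0, f t = if (t : ℝ≥0∞) < g then F t else c) :
    ‖f 0‖ₑ + eVariationOn f univ ≤ 2 * ‖F 0‖ₑ + (2 * (if g < ∞ then ‖c‖ₑ else 0) +
      2 * ∫⁻ u in beforeEnd ν, {u : ℝ≥0 | (u : ℝ≥0∞) < g}.indicator (fun u => ‖z u‖ₑ) u ∂(dG ν)) := by
  have hms : MeasurableSet {u : ℝ≥0 | (u : ℝ≥0∞) < g} :=
    measurableSet_lt measurableEmbedding_coe.measurable measurable_const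
  rw [setLIntegral_indicator hms]
  have hsub : {u : ℝ≥0 | (u : ℝ≥0∞) < g} ⊆ beforeEnd ν := fun u hu => lt_of_lt_of_le hu hg
  rw [inter_eq_left.2 hsub]
  set S : Set ℝ≥0 := {u : ℝ≥0 | (u : ℝ≥0∞) < g} with hS
  have hSle : ∀ {s t : ℝ≥0}, s ≤ t → t ∈ S → s ∈ S := fun hst ht =>
    lt_of_le_of_lt (ENNReal.coe_le_coe.2 hst) ht
  replace hf : ∀ t : ℝ≥0, f t = if t ∈ S then F t else c := hf
  set I := ∫⁻ u in S, ‖z u‖ₑ ∂(dG ν) with hI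
  set c' : ℝ≥0∞ := if g < ∞ then ‖c‖ₑ else 0 with hc'
  have hcc : ∀ {t : ℝ≥0}, t ∉ S → ‖c‖ₑ = c' := by
    intro t ht
    rw [hc', if_pos ((not_lt.1 ht).trans_lt ENNReal.coe_lt_top)]
  -- The account holds the variation of F so far and, once g is reached, a budget for the jump: |c -
  -- F(s)| ≤ |c| + |F(0)| + I. The term c' is zero when g = ∞, where c is never attained.
  set φ : ℝ≥0 → ℝ≥0∞ := fun t => ∫⁻ u in Ioc 0 t ∩ S, ‖z u‖ₑ ∂(dG ν) +
    Sᶜ.indicator (fun _ => ‖F 0‖ₑ + I + c') t with hφ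
  have hφ1 : ∀ t, ∫⁻ u in Ioc 0 t ∩ S, ‖z u‖ₑ ∂(dG ν) ≤ I := fun t =>
    lintegral_mono_set inter_subset_right
  have hφ2 : ∀ {s t}, s ≤ t → ∫⁻ u in Ioc 0 s ∩ S, ‖z u‖ₑ ∂(dG ν) ≤
      ∫⁻ u in Ioc 0 t ∩ S, ‖z u‖ₑ ∂(dG ν) := fun hst =>
    lintegral_mono_set (inter_subset_inter_left _ (Ioc_subset_Ioc_right hst))
  have h1 : ∀ s t, s ≤ t → edist (f t) (f s) + φ s ≤ φ t := by
    intro s t hst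
    by_cases ht : t ∈ S
    · have hs := hSle hst ht
      have e1 : φ s = ∫⁻ u in Ioc 0 s, ‖z u‖ₑ ∂(dG ν) := by
        simp only [hφ]
        rw [inter_eq_left.2 fun u (hu : u ∈ Ioc 0 s) => hSle hu.2 hs]
        simp [hs]
      have e2 : φ t = ∫⁻ u in Ioc 0 t, ‖z u‖ₑ ∂(dG ν) := by
        simp only [hφ]
        rw [inter_eq_left.2 fun u (hu : u ∈ Ioc 0 t) => hSle hu.2 ht]
        simp [ht]
      rw [e1, e2, hf t, hf s, if_pos ht, if_pos hs, edist_eq_enorm_sub,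
        ← Ioc_union_Ioc_eq_Ioc (zero_le : 0 ≤ s) hst,
        lintegral_union measurableSet_Ioc (Ioc_disjoint_Ioc_of_le le_rfl), add_comm]
      gcongr
      exact hF.enorm_sub_le hst (hsub ht)
    · have e2 : φ t = ∫⁻ u in Ioc 0 t ∩ S, ‖z u‖ₑ ∂(dG ν) + (‖F 0‖ₑ + I + c') := by
        simp only [hφ]; simp [ht]
      by_cases hs : s ∈ S
      · have e1 : φ s = ∫⁻ u in Ioc 0 s ∩ S, ‖z u‖ₑ ∂(dG ν) := by
          simp only [hφ]; simp [hs]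
        rw [e1, e2, hf t, hf s, if_neg ht, if_pos hs, edist_eq_enorm_sub, add_comm]
        refine add_le_add (hφ2 hst) ?_
        have e3 : ‖F s‖ₑ ≤ ‖F 0‖ₑ + I := by
          calc ‖F s‖ₑ = ‖F 0 + (F s - F 0)‖ₑ := by ring_nf
            _ ≤ ‖F 0‖ₑ + ‖F s - F 0‖ₑ := enorm_add_le _ _
            _ ≤ ‖F 0‖ₑ + I := by
              gcongr
              refine (hF.enorm_sub_le zero_le (hsub hs)).trans (lintegral_mono_set ?_)
              exact fun u hu => hSle hu.2 hs
        calc ‖c - F s‖ₑ ≤ ‖c‖ₑ + ‖F s‖ₑ := enorm_sub_le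
          _ ≤ c' + (‖F 0‖ₑ + I) := add_le_add (hcc ht).le e3
          _ = _ := add_comm _ _
      · have e1 : φ s = ∫⁻ u in Ioc 0 s ∩ S, ‖z u‖ₑ ∂(dG ν) + (‖F 0‖ₑ + I + c') := by
          simp only [hφ]; simp [hs]
        rw [e1, e2, hf t, hf s, if_neg ht, if_neg hs, edist_self, zero_add]
        exact add_le_add (hφ2 hst) le_rfl
  have h2 : ∀ t, φ t ≤ I + (‖F 0‖ₑ + I + c') := fun t =>
    add_le_add (hφ1 t) (indicator_le_self' (fun _ _ => zero_le) t)
  have h3 : ‖f 0‖ₑ ≤ ‖F 0‖ₑ + c' := by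
    rw [hf 0]
    split_ifs with h
    · exact le_self_add
    · rw [← hcc (t := 0) h]; exact le_add_self
  calc ‖f 0‖ₑ + eVariationOn f univ ≤ (‖F 0‖ₑ + c') + (I + (‖F 0‖ₑ + I + c')) :=
        add_le_add h3 (eVariationOn_univ_le h1 h2)
    _ = _ := by ring

variable {Ω : Type*} [MeasurableSpace Ω] {P : Measure Ω} [IsProbabilityMeasure P]
  {γ : Ω → ℝ≥0∞} {X : Ω → ℝ} {M : ℝ≥0 → Ω → ℝ} {H : ℝ≥0 → ℝ} {L' : Ω → ℝ}

/-- Almost surely, `M` follows `F` before `γ` and is equal to `X` afterwards. -/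
def FollowsUntil (P : Measure Ω) (γ : Ω → ℝ≥0∞) (F : ℝ≥0 → ℝ) (X : Ω → ℝ) (M : ℝ≥0 → Ω → ℝ) :
    Prop :=
  ∀ᵐ ω ∂P, ∀ t : ℝ≥0, M t ω = if (t : ℝ≥0∞) < γ ω then F t else X ω

/-- Tonelli, with P(u < γ) = Ḡ(u). -/
lemma lintegral_tailG_swap (hγ : Measurable γ) (h0 : 0 < (P.map γ) (Ioi 0))
    (hz : MemL1loc (P.map γ) z) [IsProbabilityMeasure (P.map γ)] :
    ∫⁻ ω, ∫⁻ u in beforeEnd (P.map γ), {u : ℝ≥0 | (u : ℝ≥0∞) < γ ω}.indicator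
      (fun u => ‖z u‖ₑ) u ∂(dG (P.map γ)) ∂P =
    ∫⁻ u in beforeEnd (P.map γ), ENNReal.ofReal (tailG (P.map γ) u * |z u|) ∂(dG (P.map γ)) := by
  rw [lintegral_lintegral_swap]
  · refine lintegral_congr fun u => ?_
    have h1 : ∀ ω, {u : ℝ≥0 | (u : ℝ≥0∞) < γ ω}.indicator (fun u => ‖z u‖ₑ) u =
        (γ ⁻¹' Ioi (u : ℝ≥0∞)).indicator (fun _ => ‖z u‖ₑ) ω := by
      intro ω; simp [indicator]
    simp_rw [h1]
    rw [lintegral_indicator_const (hγ measurableSet_Ioi),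
      ENNReal.ofReal_mul (tailG_nonneg _ u), ofReal_tailG, Measure.map_apply hγ measurableSet_Ioi,
      mul_comm, Real.enorm_eq_ofReal_abs]
  · have h1 : MeasurableSet {p : Ω × ℝ≥0 | (p.2 : ℝ≥0∞) < γ p.1} :=
      measurableSet_lt (measurableEmbedding_coe.measurable.comp measurable_snd)
        (hγ.comp measurable_fst)
    have h2 : AEMeasurable (fun p : Ω × ℝ≥0 => ‖z p.2‖ₑ)
        (P.prod ((dG (P.map γ)).restrict (beforeEnd (P.map γ)))) :=
      (hz.aestronglyMeasurable h0).enorm.comp_snd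
    refine (h2.indicator h1).congr (Eventually.of_forall fun p => ?_)
    simp [indicator, Function.uncurry]

/-- The mean of the pathwise bound `path_variation_le`. Every proof of type 4 goes through this
criterion. -/
lemma lintegral_totalVar_lt_top [IsProbabilityMeasure (P.map γ)] (hγ : Measurable γ)
    (h0 : 0 < (P.map γ) (Ioi 0)) (hM : FollowsUntil P γ F X M)
    (hF : IsDensity (P.map γ) F z) (hX : IntegrableOn X {ω | γ ω < ∞} P)
    (hz : ∫⁻ s in beforeEnd (P.map γ), ENNReal.ofReal (tailG (P.map γ) s * |z s|)
      ∂(dG (P.map γ)) < ∞) :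
    ∫⁻ ω, totalVar M ω ∂P < ∞ := by
  have hms : MeasurableSet {ω | γ ω < ∞} := measurableSet_lt hγ measurable_const
  have hend : ∀ᵐ ω ∂P, γ ω ≤ endpoint (P.map γ) :=
    ae_of_ae_map hγ.aemeasurable (ae_le_endpoint (P.map γ))
  have hle : ∀ᵐ ω ∂P, totalVar M ω ≤ 2 * ‖F 0‖ₑ +
      (2 * {ω | γ ω < ∞}.indicator (fun ω => ‖X ω‖ₑ) ω +
      2 * ∫⁻ u in beforeEnd (P.map γ), {u : ℝ≥0 | (u : ℝ≥0∞) < γ ω}.indicator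
        (fun u => ‖z u‖ₑ) u ∂(dG (P.map γ))) := by
    filter_upwards [hM, hend] with ω h1 h2
    simpa only [indicator_apply, mem_ofPred_eq] using! path_variation_le hF h2 h1
  have hXm : AEMeasurable ({ω | γ ω < ∞}.indicator (fun ω => ‖X ω‖ₑ)) P :=
    (aemeasurable_indicator_iff hms).2 hX.aestronglyMeasurable.enorm
  refine (lintegral_mono_ae hle).trans_lt ?_
  rw [lintegral_add_left measurable_const, lintegral_const, lintegral_add_left' (hXm.const_mul _),
    lintegral_const_mul'' _ hXm, lintegral_const_mul' _ _ ENNReal.ofNat_ne_top,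
    lintegral_tailG_swap hγ h0 hF.1, lintegral_indicator hms]
  have h2 : (2 : ℝ≥0∞) < ∞ := by simp
  refine ENNReal.add_lt_top.2 ⟨?_, ENNReal.add_lt_top.2 ⟨ENNReal.mul_lt_top h2 hX.2,
    ENNReal.mul_lt_top h2 hz⟩⟩
  simp [ENNReal.mul_lt_top_iff]

lemma enorm_le_totalVar (t : ℝ≥0) (ω : Ω) : ‖M t ω‖ₑ ≤ totalVar M ω := by
  calc ‖M t ω‖ₑ = ‖M 0 ω + (M t ω - M 0 ω)‖ₑ := by ring_nf
    _ ≤ ‖M 0 ω‖ₑ + ‖M t ω - M 0 ω‖ₑ := enorm_add_le _ _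
    _ ≤ _ := by
      rw [totalVar, ← edist_eq_enorm_sub]
      gcongr
      exact eVariationOn.edist_le _ (mem_univ _) (mem_univ _)

/-- On {0 < γ < ∞} with γ < t_G, the value F(γ-) is a limit of values of the path, so |F(γ-)| ≤
sup|M|; the law of γ turns this into a dG-integral. -/
lemma lintegral_leftValue_lt_top [IsProbabilityMeasure (P.map γ)] (hγ : Measurable γ)
    (h0 : 0 < (P.map γ) (Ioi 0)) (hM : FollowsUntil P γ F X M)
    (hF : IsDensity (P.map γ) F z) (hH : MemL1loc (P.map γ) H) (hMain : MainEq (P.map γ) F H)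
    (hsup : ∫⁻ ω, (⨆ t, ‖M t ω‖ₑ) ∂P < ∞) :
    ∫⁻ s in beforeEnd (P.map γ) ∩ Ioi 0, ‖leftValue (P.map γ) F z s‖ₑ ∂(dG (P.map γ)) < ∞ := by
  have hms : MeasurableSet (beforeEnd (P.map γ) ∩ Ioi 0) :=
    (measurableSet_beforeEnd _).inter measurableSet_Ioi
  have hmono : (dG (P.map γ)).restrict (beforeEnd (P.map γ) ∩ Ioi 0) ≤
    (dG (P.map γ)).restrict (beforeEnd (P.map γ)) := Measure.restrict_mono_set _ inter_subset_left
  have hm : AEStronglyMeasurable (leftValue (P.map γ) F z)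
      ((dG (P.map γ)).restrict (beforeEnd (P.map γ) ∩ Ioi 0)) := by
    refine AEStronglyMeasurable.congr ?_ (EventuallyEq.symm (leftValue_ae_eq h0 hF hH hMain))
    exact ((measurable_tailG _).aestronglyMeasurable.mul
      ((hF.1.aestronglyMeasurable h0).mono_measure hmono)).add
      ((hH.aestronglyMeasurable h0).mono_measure hmono)
  rw [← lintegral_indicator hms, lintegral_dG_map hγ ((aemeasurable_indicator_iff hms).2 hm.enorm)]
  refine lt_of_le_of_lt ?_ hsup
  refine (lintegral_mono_ae (μ := P.restrict {ω | γ ω < ∞}) (g := fun ω => ⨆ t, ‖M t ω‖ₑ) ?_).trans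
    (setLIntegral_le_lintegral _ _)
  filter_upwards [ae_restrict_of_ae hM, ae_restrict_mem (measurableSet_lt hγ measurable_const)]
    with ω hω hfin
  by_cases hs : (γ ω).toNNReal ∈ beforeEnd (P.map γ) ∩ Ioi 0
  · rw [indicator_of_mem hs]
    have : (𝓝[<] (γ ω).toNNReal).NeBot := nhdsLT_neBot_of_exists_lt ⟨0, hs.2⟩
    refine le_of_tendsto (hF.tendsto_leftValue hs.1).enorm ?_
    filter_upwards [self_mem_nhdsWithin] with t ht
    have h1 : (t : ℝ≥0∞) < γ ω := by
      rw [← ENNReal.coe_toNNReal (ne_of_lt hfin)]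
      exact ENNReal.coe_lt_coe.2 ht
    have h2 := hω t
    rw [if_pos h1] at h2
    rw [← h2]
    exact le_iSup (fun t => ‖M t ω‖ₑ) t
  · rw [indicator_of_notMem hs]
    exact zero_le

/-! ### The martingale difference part -/

/-- The generalized conditional expectation gives equal integrals of L'⁺ and L'⁻ over γ-events;
integrability on the event permits subtracting them. -/
lemma CondExpZero.setIntegral_eq_zero (hγ : Measurable γ) (hL : CondExpZero P γ L')
    {B : Set ℝ≥0∞} (hB : MeasurableSet B) (hint : IntegrableOn L' (γ ⁻¹' B) P) :
    ∫ ω in γ ⁻¹' B, L' ω ∂P = 0 := by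
  have hm : MeasurableSpace.comap γ inferInstance ≤ (inferInstance : MeasurableSpace Ω) :=
    hγ.comap_le
  have hB' : MeasurableSet[MeasurableSpace.comap γ inferInstance] (γ ⁻¹' B) := ⟨B, hB, rfl⟩
  have h1 : ∫⁻ ω in γ ⁻¹' B, ENNReal.ofReal (L' ω) ∂P =
      ∫⁻ ω in γ ⁻¹' B, ENNReal.ofReal (-L' ω) ∂P := by
    rw [← setLIntegral_condLExp hm P (fun ω => ENNReal.ofReal (L' ω)) hB',
      ← setLIntegral_condLExp hm P (fun ω => ENNReal.ofReal (-L' ω)) hB']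
    exact lintegral_congr_ae (ae_restrict_of_ae hL.2)
  rw [integral_eq_lintegral_pos_part_sub_lintegral_neg_part hint, h1, sub_self]

lemma setLIntegral_enorm_le {μ : Measure Ω} {f g : Ω → ℝ} (hf : Integrable f μ)
    (h0 : 0 ≤ᵐ[μ] f) (h : ∫ ω, f ω ∂μ = ∫ ω, g ω ∂μ) :
    ∫⁻ ω, ‖f ω‖ₑ ∂μ ≤ ∫⁻ ω, ‖g ω‖ₑ ∂μ := by
  have h1 : ∫⁻ ω, ‖f ω‖ₑ ∂μ = ENNReal.ofReal (∫ ω, f ω ∂μ) := by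
    rw [ofReal_integral_eq_lintegral_ofReal hf h0]
    refine lintegral_congr_ae ?_
    filter_upwards [h0] with ω hω
    exact Real.enorm_of_nonneg hω
  rw [h1, h]
  exact (Real.ofReal_le_enorm _).trans (enorm_integral_le_lintegral_enorm _)

/-- Conditional Jensen by hand: split according to the sign of h. On each piece ∫|h(γ)| = |∫ h(γ)| =
|∫ (h(γ) + L')|, because L' integrates to zero over γ-events. -/
lemma lintegral_enorm_le_of_condExpZero (hγ : Measurable γ) (hL : CondExpZero P γ L')
    {h : ℝ≥0∞ → ℝ} (hh : Measurable h) {A : Set ℝ≥0∞} (hA : MeasurableSet A)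
    (hi : IntegrableOn (fun ω => h (γ ω)) (γ ⁻¹' A) P) (hLi : IntegrableOn L' (γ ⁻¹' A) P) :
    ∫⁻ ω in γ ⁻¹' A, ‖h (γ ω)‖ₑ ∂P ≤ ∫⁻ ω in γ ⁻¹' A, ‖h (γ ω) + L' ω‖ₑ ∂P := by
  have hS : MeasurableSet {x | 0 ≤ h x} := measurableSet_le measurable_const hh
  rw [← lintegral_inter_add_sdiff _ (γ ⁻¹' A) (hγ hS),
    ← lintegral_inter_add_sdiff (fun ω => ‖h (γ ω) + L' ω‖ₑ) (γ ⁻¹' A) (hγ hS),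
    ← preimage_inter, ← preimage_sdiff]
  have e : ∀ {B : Set ℝ≥0∞}, MeasurableSet B → B ⊆ A →
      ∫ ω in γ ⁻¹' B, (h (γ ω) + L' ω) ∂P = ∫ ω in γ ⁻¹' B, h (γ ω) ∂P := by
    intro B hB hBA
    rw [integral_add (hi.mono_set (preimage_mono hBA)) (hLi.mono_set (preimage_mono hBA)),
      hL.setIntegral_eq_zero hγ hB (hLi.mono_set (preimage_mono hBA)), add_zero]
  refine add_le_add ?_ ?_
  · refine setLIntegral_enorm_le (hi.mono_set (preimage_mono inter_subset_left)) ?_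
      (e (hA.inter hS) inter_subset_left).symm
    filter_upwards [ae_restrict_mem (hγ (hA.inter hS))] with ω hω
    exact hω.2
  · have h1 := setLIntegral_enorm_le (μ := P.restrict (γ ⁻¹' (A \ {x | 0 ≤ h x})))
      (f := fun ω => -h (γ ω)) (g := fun ω => -(h (γ ω) + L' ω))
      (hi.mono_set (preimage_mono sdiff_subset)).neg ?_ ?_
    · simpa only [enorm_neg] using h1
    · filter_upwards [ae_restrict_mem (hγ (MeasurableSet.diff hA hS))] with ω hω
      have := hω.2
      simp only [mem_ofPred_eq, not_le] at this
      simp only [Pi.zero_apply]; linarith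
    · rw [integral_neg, integral_neg, e (MeasurableSet.diff hA hS) sdiff_subset]

end

section

/-! ### Integrability of the terminal value -/

variable {Ω : Type*} [mΩ : MeasurableSpace Ω] {P : Measure Ω} [IsProbabilityMeasure P]
  {γ : Ω → ℝ≥0∞} {X L' : Ω → ℝ} {M : ℝ≥0 → Ω → ℝ} {F H z : ℝ≥0 → ℝ}

/-- The value of the process at and after the jump time. -/
def jumpValue (γ : Ω → ℝ≥0∞) (H : ℝ≥0 → ℝ) (L' : Ω → ℝ) (ω : Ω) : ℝ := H (γ ω).toNNReal + L' ω

lemma IsRepresentedLocalMartingale.followsUntil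
    (h : IsRepresentedLocalMartingale P γ F H L' M) :
    FollowsUntil P γ F (jumpValue γ H L') M := by
  filter_upwards [h.representation] with ω hω t
  rw [hω t]
  by_cases ht : (t : ℝ≥0∞) < γ ω
  · simp [indicator, ht, not_le.2 ht]
  · simp [indicator, ht, not_lt.1 ht, jumpValue]

lemma setOf_toNNReal_mem_Iic (t : ℝ≥0) :
    {ω | γ ω < ∞ ∧ (γ ω).toNNReal ∈ Iic t} = γ ⁻¹' Iic (t : ℝ≥0∞) := by
  ext ω
  constructor
  · rintro ⟨h1, h2⟩
    rw [mem_preimage, ← ENNReal.coe_toNNReal h1.ne]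
    exact ENNReal.coe_le_coe.2 h2
  · intro h
    have h1 : γ ω < ∞ := lt_of_le_of_lt h ENNReal.coe_lt_top
    refine ⟨h1, ?_⟩
    rw [mem_preimage, ← ENNReal.coe_toNNReal h1.ne] at h
    exact ENNReal.coe_le_coe.1 h

lemma setOf_toNNReal_mem_Ioc (s t : ℝ≥0) :
    {ω | γ ω < ∞ ∧ (γ ω).toNNReal ∈ Ioc s t} = γ ⁻¹' Ioc (s : ℝ≥0∞) t := by
  have h1 := setOf_toNNReal_mem_Iic (γ := γ) t
  have h2 := setOf_toNNReal_mem_Iic (γ := γ) s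
  rw [← Iic_sdiff_Iic, ← Iic_sdiff_Iic, preimage_sdiff, ← h1, ← h2]
  ext ω
  simp only [mem_ofPred_eq, Set.mem_sdiff]
  tauto

lemma ae_exists_le_of_lt_top (hγ : Measurable γ) [IsProbabilityMeasure (P.map γ)]
    (hA : CaseA (P.map γ)) :
    ∀ᵐ ω ∂P, γ ω < ∞ → (γ ω).toNNReal ∈ beforeEnd (P.map γ) := by
  filter_upwards [ae_of_ae_map hγ.aemeasurable (ae_lt_endpoint (P.map γ) hA)] with ω hω hfin
  have := hω hfin
  rwa [← ENNReal.coe_toNNReal hfin.ne] at this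

lemma MemL1loc.aestronglyMeasurable_dG {ν : Measure ℝ≥0∞} [IsProbabilityMeasure ν]
    (h0 : 0 < ν (Ioi 0)) (hH : MemL1loc ν H) (hA : CaseA ν) : AEStronglyMeasurable H (dG ν) := by
  rw [← restrict_beforeEnd ν hA]
  exact hH.aestronglyMeasurable h0

section

variable [IsProbabilityMeasure (P.map γ)]

/-- H and L' are only locally integrable, so Jensen is applied on {γ ≤ t_n} and extended by monotone
convergence; in Case A these events exhaust {γ < ∞} up to a null set. -/
lemma lintegral_H_le (hγ : Measurable γ) (h0 : 0 < (P.map γ) (Ioi 0)) (hA : CaseA (P.map γ))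
    (hH : MemL1loc (P.map γ) H) (hL : CondExpZero P γ L')
    (hLi : ∀ t ∈ timeSet (P.map γ), IntegrableOn L' {ω | γ ω ≤ (t : ℝ≥0∞)} P) :
    ∫⁻ ω in {ω | γ ω < ∞}, ‖H (γ ω).toNNReal‖ₑ ∂P ≤
      ∫⁻ ω in {ω | γ ω < ∞}, ‖jumpValue γ H L' ω‖ₑ ∂P := by
  obtain ⟨t, ht, hmem, hex⟩ := exists_seq_beforeEnd h0
  have hHm := hH.aestronglyMeasurable_dG h0 hA
  have hU : ({ω | γ ω < ∞} : Set Ω) =ᵐ[P] ⋃ n, γ ⁻¹' Iic (t n : ℝ≥0∞) := by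
    filter_upwards [ae_exists_le_of_lt_top hγ hA] with ω hω
    refine propext ⟨fun h => ?_, fun h => ?_⟩
    · obtain ⟨n, hn⟩ := hex _ (hω h)
      refine mem_iUnion.2 ⟨n, ?_⟩
      rw [mem_preimage, ← ENNReal.coe_toNNReal (ne_of_lt h)]
      exact ENNReal.coe_le_coe.2 hn
    · obtain ⟨n, hn⟩ := mem_iUnion.1 h
      exact lt_of_le_of_lt hn ENNReal.coe_lt_top
  have hdir : Directed (· ⊆ ·) fun n => γ ⁻¹' Iic (t n : ℝ≥0∞) :=
    Monotone.directed_le fun m n h => preimage_mono (Iic_subset_Iic.2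
      (ENNReal.coe_le_coe.2 (ht.monotone h)))
  rw [setLIntegral_congr hU, setLIntegral_congr hU, setLIntegral_iUnion_of_directed _ hdir,
    setLIntegral_iUnion_of_directed _ hdir]
  refine iSup_mono fun n => ?_
  have hts := beforeEnd_subset_timeSet _ (hmem n)
  -- H is only almost everywhere measurable for dG, while splitting by sign needs a Borel function
  -- of γ.
  set h : ℝ≥0∞ → ℝ := fun x => hHm.mk H x.toNNReal with hh
  have hae : ∀ᵐ ω ∂(P.restrict {ω | γ ω < ∞}), H (γ ω).toNNReal = h (γ ω) :=
    (quasiMeasurePreserving hγ).ae hHm.ae_eq_mk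
  have hae' : ∀ᵐ ω ∂(P.restrict (γ ⁻¹' Iic (t n : ℝ≥0∞))), H (γ ω).toNNReal = h (γ ω) :=
    ae_restrict_of_ae_restrict_of_subset (fun ω hω => lt_of_le_of_lt hω ENNReal.coe_lt_top) hae
  have hi : IntegrableOn (fun ω => h (γ ω)) (γ ⁻¹' Iic (t n : ℝ≥0∞)) P := by
    have := (integrableOn_dG_map hγ measurableSet_Iic hHm).1 (hH.2 _ hts)
    rw [setOf_toNNReal_mem_Iic] at this
    exact Integrable.congr this hae'
  have key := lintegral_enorm_le_of_condExpZero hγ hL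
    (hHm.stronglyMeasurable_mk.measurable.comp ENNReal.measurable_toNNReal) measurableSet_Iic hi
    (hLi _ hts)
  calc ∫⁻ ω in γ ⁻¹' Iic (t n : ℝ≥0∞), ‖H (γ ω).toNNReal‖ₑ ∂P
      = ∫⁻ ω in γ ⁻¹' Iic (t n : ℝ≥0∞), ‖h (γ ω)‖ₑ ∂P :=
        lintegral_congr_ae (hae'.mono fun ω hω => by simp only [hω])
    _ ≤ ∫⁻ ω in γ ⁻¹' Iic (t n : ℝ≥0∞), ‖h (γ ω) + L' ω‖ₑ ∂P := key
    _ = ∫⁻ ω in γ ⁻¹' Iic (t n : ℝ≥0∞), ‖jumpValue γ H L' ω‖ₑ ∂P :=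
        lintegral_congr_ae (hae'.mono fun ω hω => by simp only [jumpValue, hω])

lemma lintegral_H_eq (hγ : Measurable γ) (hHm : AEStronglyMeasurable H (dG (P.map γ))) :
    ∫⁻ s, ‖H s‖ₑ ∂(dG (P.map γ)) = ∫⁻ ω in {ω | γ ω < ∞}, ‖H (γ ω).toNNReal‖ₑ ∂P :=
  lintegral_dG_map hγ hHm.enorm

lemma aestronglyMeasurable_H_comp (hγ : Measurable γ)
    (hHm : AEStronglyMeasurable H (dG (P.map γ))) :
    AEStronglyMeasurable (fun ω => H (γ ω).toNNReal) (P.restrict {ω | γ ω < ∞}) :=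
  hHm.comp_quasiMeasurePreserving (quasiMeasurePreserving hγ)

lemma integrableOn_jumpValue (hγ : Measurable γ) (hHm : AEStronglyMeasurable H (dG (P.map γ)))
    (hHi : ∫⁻ s, ‖H s‖ₑ ∂(dG (P.map γ)) < ∞) (hLm : Measurable L')
    (hLi : ∫⁻ ω in {ω | γ ω < ∞}, ‖L' ω‖ₑ ∂P < ∞) :
    IntegrableOn (jumpValue γ H L') {ω | γ ω < ∞} P := by
  rw [lintegral_H_eq hγ hHm] at hHi
  exact Integrable.add ⟨aestronglyMeasurable_H_comp hγ hHm, hHi⟩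
    ⟨hLm.aestronglyMeasurable, hLi⟩

end

lemma FollowsUntil.tendsto (hM : FollowsUntil P γ F X M) :
    ∀ᵐ ω ∂P, γ ω < ∞ → Tendsto (fun t => M t ω) atTop (𝓝 (X ω)) := by
  filter_upwards [hM] with ω hω hfin
  refine tendsto_const_nhds.congr' ?_
  filter_upwards [eventually_ge_atTop (γ ω).toNNReal] with t ht
  have : γ ω ≤ t := by
    rw [← ENNReal.coe_toNNReal hfin.ne]
    exact ENNReal.coe_le_coe.2 ht
  rw [hω t, if_neg (not_lt.2 this)]

lemma FollowsUntil.terminal_eq (hM : FollowsUntil P γ F X M) :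
    ∀ᵐ ω ∂P, γ ω < ∞ → terminal M ω = X ω := by
  filter_upwards [hM.tendsto] with ω hω hfin
  exact (hω hfin).limUnder_eq

lemma FollowsUntil.tendsto_of_eq_top (hM : FollowsUntil P γ F X M) {l : ℝ}
    (hF : Tendsto F atTop (𝓝 l)) :
    ∀ᵐ ω ∂P, γ ω = ∞ → Tendsto (fun t => M t ω) atTop (𝓝 l) := by
  filter_upwards [hM] with ω hω htop
  refine hF.congr fun t => ?_
  rw [hω t, htop, if_pos ENNReal.coe_lt_top]

/-! ### Type 1, and type 4 when Ḡ is bounded below -/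

section

variable [IsProbabilityMeasure (P.map γ)]

lemma real_eq_top_le_tailG (hγ : Measurable γ) (t : ℝ≥0) :
    P.real {ω | γ ω = ∞} ≤ tailG (P.map γ) t := by
  rw [tailG_eq, map_measureReal_apply hγ measurableSet_Ioi]
  exact measureReal_mono fun ω (hω : γ ω = ∞) => by simp [hω]

lemma real_eq_top_pos (hp : 0 < P {ω | γ ω = ∞}) : 0 < P.real {ω | γ ω = ∞} :=
  ENNReal.toReal_pos hp.ne' (measure_ne_top _ _)

lemma beforeEnd_eq_univ (hγ : Measurable γ) (hp : 0 < P {ω | γ ω = ∞}) :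
    beforeEnd (P.map γ) = univ :=
  eq_univ_of_forall fun t => (mem_beforeEnd_iff _).2
    ((real_eq_top_pos hp).trans_le (real_eq_top_le_tailG hγ t))

lemma endpoint_eq_top {ν : Measure ℝ≥0∞} (h : beforeEnd ν = univ) : endpoint ν = ∞ := by
  by_contra hne
  have : (endpoint ν).toNNReal ∈ beforeEnd ν := by rw [h]; trivial
  exact absurd (ENNReal.coe_toNNReal hne) (ne_of_lt this)

lemma atTop_le_toEnd {ν : Measure ℝ≥0∞} (h : beforeEnd ν = univ) : atTop ≤ toEnd ν := by
  rw [toEnd, endpoint_eq_top h, ← tendsto_iff_comap]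
  exact tendsto_nhdsWithin_iff.2 ⟨ENNReal.tendsto_coe_nhds_top.2 tendsto_id,
    Eventually.of_forall fun t => ENNReal.coe_lt_top⟩

/-- F is the quotient of FḠ and Ḡ; both converge, and the limit of Ḡ is at least P(γ = ∞) > 0. -/
lemma exists_tendsto_F (hγ : Measurable γ) (hp : 0 < P {ω | γ ω = ∞})
    (hMain : MainEq (P.map γ) F H) (hHm : AEStronglyMeasurable H (dG (P.map γ)))
    (hHi : ∫⁻ s, ‖H s‖ₑ ∂(dG (P.map γ)) < ∞) : ∃ l, Tendsto F atTop (𝓝 l) := by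
  have hu := beforeEnd_eq_univ hγ hp
  have h1 := (hMain.tendsto (Integrable.integrableOn ⟨hHm, hHi⟩)).mono_left (atTop_le_toEnd hu)
  have h2 := tendsto_atTop_ciInf (tailG_antitone (P.map γ)) ⟨0, by
    rintro _ ⟨t, rfl⟩; exact tailG_nonneg _ t⟩
  have hpos : 0 < ⨅ t, tailG (P.map γ) t :=
    (real_eq_top_pos hp).trans_le (le_ciInf (real_eq_top_le_tailG hγ))
  refine ⟨_, (h1.div h2 hpos.ne').congr fun t => ?_⟩
  have : 0 < tailG (P.map γ) t := (real_eq_top_pos hp).trans_le (real_eq_top_le_tailG hγ t)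
  simp only [Pi.div_apply]
  field_simp

/-- Only X matters: M_∞ = X on {γ < ∞}, while on {γ = ∞}, if charged, an integrable H makes M_∞ the
constant lim F. In the other direction, integrability of X gives that of H(γ) by `lintegral_H_le`,
then that of L' by difference. -/
lemma hasType1_iff (hγ : Measurable γ) (h0 : 0 < (P.map γ) (Ioi 0))
    (hM : IsRepresentedLocalMartingale P γ F H L' M) (hA : CaseA (P.map γ)) :
    HasType (singleJumpFiltration γ) P M .type1 ↔
      (∫⁻ ω in {ω | γ ω < ∞}, ‖L' ω‖ₑ ∂P = ∞ ∨
        ∫⁻ s in beforeEnd (P.map γ), ‖H s‖ₑ ∂(dG (P.map γ)) = ∞) := by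
  have hHm := hM.conditionM.memL1loc.aestronglyMeasurable_dG h0 hA
  have hfol := hM.followsUntil
  have hms : MeasurableSet {ω | γ ω < ∞} := measurableSet_lt hγ measurable_const
  rw [restrict_beforeEnd _ hA]
  have hterm : ∀ᵐ ω ∂(P.restrict {ω | γ ω < ∞}), ‖terminal M ω‖ₑ = ‖jumpValue γ H L' ω‖ₑ := by
    rw [ae_restrict_iff' hms]
    filter_upwards [hfol.terminal_eq] with ω hω h
    rw [hω h]
  constructor
  · contrapose!
    rintro ⟨hL, hH⟩
    rw [← lt_top_iff_ne_top] at hL hH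
    have hX := integrableOn_jumpValue hγ hHm hH hM.measurable_L' hL
    have hlim : ∃ l, ∀ᵐ ω ∂P, γ ω = ∞ → Tendsto (fun t => M t ω) atTop (𝓝 l) := by
      rcases eq_or_ne (P {ω | γ ω = ∞}) 0 with hp | hp
      · exact ⟨0, by filter_upwards [measure_eq_zero_iff_ae_notMem.1 hp] with ω hω h
                     exact absurd h hω⟩
      · obtain ⟨l, hl⟩ := exists_tendsto_F hγ (pos_iff_ne_zero.2 hp) hM.conditionM.main hHm hH
        exact ⟨l, hfol.tendsto_of_eq_top hl⟩
    obtain ⟨l, hl⟩ := hlim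
    have hHas : HasLimit P M := by
      filter_upwards [hl, hfol.tendsto] with ω h1 h2
      rcases eq_or_ne (γ ω) ∞ with h | h
      · exact ⟨_, h1 h⟩
      · exact ⟨_, h2 (lt_top_iff_ne_top.2 h)⟩
    simp only [HasType, not_or, not_not, not_and]
    refine ⟨hHas, fun _ => ne_of_lt ?_⟩
    rw [← lintegral_add_compl _ hms, lintegral_congr_ae hterm]
    refine ENNReal.add_lt_top.2 ⟨hX.2, ?_⟩
    calc ∫⁻ ω in {ω | γ ω < ∞}ᶜ, ‖terminal M ω‖ₑ ∂P = ∫⁻ ω in {ω | γ ω < ∞}ᶜ, ‖l‖ₑ ∂P := by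
          refine lintegral_congr_ae ((ae_restrict_iff' hms.compl).2 ?_)
          filter_upwards [hl] with ω hω h
          rw [terminal, (hω (by simpa using h)).limUnder_eq]
      _ < ∞ := by
          rw [setLIntegral_const]
          exact ENNReal.mul_lt_top enorm_lt_top (measure_lt_top _ _)
  · intro h
    by_contra hc
    simp only [HasType, not_or, not_not, not_and] at hc
    have hX : ∫⁻ ω in {ω | γ ω < ∞}, ‖jumpValue γ H L' ω‖ₑ ∂P < ∞ := by
      rw [← lintegral_congr_ae hterm]
      exact (setLIntegral_le_lintegral _ _).trans_lt (lt_top_iff_ne_top.2 (hc.2 hc.1))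
    have hHi := (lintegral_H_le hγ h0 hA hM.conditionM.memL1loc hM.condExpZero_L'
      hM.integrableOn_L').trans_lt hX
    rcases h with h | h
    · refine absurd h (ne_of_lt ?_)
      calc ∫⁻ ω in {ω | γ ω < ∞}, ‖L' ω‖ₑ ∂P
          ≤ ∫⁻ ω in {ω | γ ω < ∞}, (‖jumpValue γ H L' ω‖ₑ + ‖H (γ ω).toNNReal‖ₑ) ∂P := by
            refine lintegral_mono fun ω => ?_
            have : L' ω = jumpValue γ H L' ω - H (γ ω).toNNReal := by simp [jumpValue]
            rw [this]
            exact enorm_sub_le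
        _ < ∞ := by
            rw [lintegral_add_right' _ (aestronglyMeasurable_H_comp hγ hHm).enorm]
            exact ENNReal.add_lt_top.2 ⟨hX, hHi⟩
    · rw [lintegral_H_eq hγ hHm] at h
      exact absurd h hHi.ne

lemma hasType4_of_eq_top_pos (hγ : Measurable γ) (h0 : 0 < (P.map γ) (Ioi 0))
    (hM : IsRepresentedLocalMartingale P γ F H L' M) (hA : CaseA (P.map γ))
    (hp : 0 < P {ω | γ ω = ∞}) (hL : ∫⁻ ω in {ω | γ ω < ∞}, ‖L' ω‖ₑ ∂P < ∞)
    (hH : ∫⁻ s, ‖H s‖ₑ ∂(dG (P.map γ)) < ∞) :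
    HasType (singleJumpFiltration γ) P M .type4 := by
  have hHm := hM.conditionM.memL1loc.aestronglyMeasurable_dG h0 hA
  obtain ⟨z, hz⟩ := hM.conditionM.absCont
  refine lintegral_totalVar_lt_top hγ h0 hM.followsUntil hz
    (integrableOn_jumpValue hγ hHm hH hM.measurable_L' hL) ?_
  exact lintegral_tailG_lt_top_of_le_tailG h0 hz hM.conditionM.memL1loc hM.conditionM.main
    ((setLIntegral_le_lintegral _ _).trans_lt hH) (real_eq_top_pos hp)
    fun t _ => real_eq_top_le_tailG hγ t

/-- The atom puts T = t_G itself in `timeSet`, so local integrability up to T is global, and its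
mass bounds Ḡ from below on [0, T). -/
lemma hasType4_of_caseB (hγ : Measurable γ) (h0 : 0 < (P.map γ) (Ioi 0))
    (hM : IsRepresentedLocalMartingale P γ F H L' M) (hB : CaseB (P.map γ)) :
    HasType (singleJumpFiltration γ) P M .type4 := by
  obtain ⟨z, hz⟩ := hM.conditionM.absCont
  set ν := P.map γ with hν
  have hfin : endpoint ν ≠ ∞ := by
    intro h
    have : {x : ℝ≥0∞ | x = endpoint ν ∧ x < ∞} = ∅ := by
      ext x; simp only [mem_ofPred_eq, mem_empty_iff_false, iff_false, not_and, h]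
      rintro rfl; simp
    rw [CaseB, this] at hB
    simp at hB
  obtain ⟨T, hT⟩ : ∃ T : ℝ≥0, (T : ℝ≥0∞) = endpoint ν := ⟨_, ENNReal.coe_toNNReal hfin⟩
  have hB' : 0 < ν {(T : ℝ≥0∞)} := by
    refine hB.trans_le (measure_mono fun x hx => ?_)
    rw [mem_singleton_iff, hT]; exact hx.1
  have hTmem : T ∈ timeSet ν := hB'.trans_le (measure_mono (by simp))
  have hle : ∀ᵐ ω ∂P, γ ω ≤ T := by
    rw [hT]; exact ae_of_ae_map hγ.aemeasurable (ae_le_endpoint ν)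
  have hHi : Integrable H (dG ν) := by
    have h1 := hM.conditionM.memL1loc.2 T hTmem
    rwa [IntegrableOn, Measure.restrict_eq_self_of_ae_mem] at h1
    rw [dG_map hγ]
    refine (ae_map_iff hγ.ennreal_toNNReal.aemeasurable measurableSet_Iic).2
      (ae_restrict_of_ae ?_)
    filter_upwards [hle] with ω hω
    simpa using ENNReal.toNNReal_mono ENNReal.coe_ne_top hω
  have hLi : Integrable L' P := by
    have h1 := hM.integrableOn_L' T hTmem
    rwa [IntegrableOn, Measure.restrict_eq_self_of_ae_mem] at h1
    exact hle
  refine lintegral_totalVar_lt_top hγ h0 hM.followsUntil hz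
    (integrableOn_jumpValue hγ hHi.1 hHi.2 hM.measurable_L' hLi.integrableOn.2) ?_
  refine lintegral_tailG_lt_top_of_le_tailG (c := ν.real {(T : ℝ≥0∞)}) h0 hz
    hM.conditionM.memL1loc hM.conditionM.main
    ((setLIntegral_le_lintegral _ _).trans_lt hHi.2)
    (ENNReal.toReal_pos hB'.ne' (measure_ne_top _ _)) fun t ht => ?_
  rw [tailG_eq]
  refine measureReal_mono (singleton_subset_iff.2 ?_)
  rw [hT]; exact ht

end

end

section

/-! ### Conditional expectations in the single jump filtration -/

variable {Ω : Type*} [mΩ : MeasurableSpace Ω] {P : Measure Ω} [IsProbabilityMeasure P]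
  {γ : Ω → ℝ≥0∞} {X L' : Ω → ℝ} {M : ℝ≥0 → Ω → ℝ} {F H z : ℝ≥0 → ℝ}

lemma measurableSet_singleJump {t : ℝ≥0} {A : Set Ω} :
    MeasurableSet[singleJumpFiltration γ t] A ↔ MeasurableSet A ∧
      (A ∩ {ω | (t : ℝ≥0∞) < γ ω} = ∅ ∨
        A ∩ {ω | (t : ℝ≥0∞) < γ ω} = {ω | (t : ℝ≥0∞) < γ ω}) := Iff.rfl

/-- A set of the σ-field at time s contains {s < γ} or misses it, and N = Y off {s < γ}. Comparing
conditional expectations thus takes a single integral inequality. -/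
lemma condExp_le_of_setIntegral_le {Y N : Ω → ℝ} {s : ℝ≥0} (hY : Integrable Y P)
    (hN : Integrable N P) (hNm : StronglyMeasurable[singleJumpFiltration γ s] N)
    (heq : ∀ᵐ ω ∂P, γ ω ≤ s → N ω = Y ω)
    (hle : ∫ ω in {ω | (s : ℝ≥0∞) < γ ω}, Y ω ∂P ≤ ∫ ω in {ω | (s : ℝ≥0∞) < γ ω}, N ω ∂P) :
    P[Y | singleJumpFiltration γ s] ≤ᵐ[P] N := by
  set 𝓕 := singleJumpFiltration γ
  have hm := 𝓕.le s
  -- The difference is measurable for the small σ-field, so after trimming its sign is tested only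
  -- on sets of that σ-field.
  suffices 0 ≤ᵐ[P.trim hm] N - P[Y | 𝓕 s] by
    filter_upwards [ae_le_of_ae_le_trim this] with ω hω
    simpa using hω
  have hsm : StronglyMeasurable[𝓕 s] (N - P[Y | 𝓕 s]) := hNm.sub stronglyMeasurable_condExp
  refine ae_nonneg_of_forall_setIntegral_nonneg
    ((hN.sub integrable_condExp).trim hm hsm) fun A hA _ => ?_
  rw [← setIntegral_trim hm hsm hA, integral_sub' hN.integrableOn integrable_condExp.integrableOn,
    setIntegral_condExp hm hY hA, ← integral_sub hN.integrableOn hY.integrableOn]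
  obtain ⟨hAm, hA2⟩ := measurableSet_singleJump.1 hA
  have e1 : ∫ ω in A, (N ω - Y ω) ∂P =
      ∫ ω in A ∩ {ω | (s : ℝ≥0∞) < γ ω}, (N ω - Y ω) ∂P := by
    refine setIntegral_eq_of_subset_of_ae_sdiff_eq_zero hAm.nullMeasurableSet inter_subset_left ?_
    filter_upwards [heq] with ω hω h
    have : γ ω ≤ s := not_lt.1 fun h' => h.2 ⟨h.1, h'⟩
    rw [hω this, sub_self]
  rw [e1]
  rcases hA2 with h | h
  · simp [h]
  · rw [h, integral_sub hN.integrableOn hY.integrableOn]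
    linarith

lemma le_condExp_of_setIntegral_le {Y N : Ω → ℝ} {s : ℝ≥0} (hY : Integrable Y P)
    (hN : Integrable N P) (hNm : StronglyMeasurable[singleJumpFiltration γ s] N)
    (heq : ∀ᵐ ω ∂P, γ ω ≤ s → N ω = Y ω)
    (hle : ∫ ω in {ω | (s : ℝ≥0∞) < γ ω}, N ω ∂P ≤ ∫ ω in {ω | (s : ℝ≥0∞) < γ ω}, Y ω ∂P) :
    N ≤ᵐ[P] P[Y | singleJumpFiltration γ s] := by
  have h := condExp_le_of_setIntegral_le hY.neg hN.neg hNm.neg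
    (heq.mono fun ω h hs => by simp [h hs]) (by simpa [integral_neg] using hle)
  filter_upwards [h, condExp_neg Y (singleJumpFiltration γ s)] with ω h1 h2
  rw [h2] at h1
  simpa using h1

lemma condExp_eq_of_setIntegral_eq {Y N : Ω → ℝ} {s : ℝ≥0} (hY : Integrable Y P)
    (hN : Integrable N P) (hNm : StronglyMeasurable[singleJumpFiltration γ s] N)
    (heq : ∀ᵐ ω ∂P, γ ω ≤ s → N ω = Y ω)
    (h : ∫ ω in {ω | (s : ℝ≥0∞) < γ ω}, N ω ∂P = ∫ ω in {ω | (s : ℝ≥0∞) < γ ω}, Y ω ∂P) :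
    P[Y | singleJumpFiltration γ s] =ᵐ[P] N :=
  (condExp_le_of_setIntegral_le hY hN hNm heq h.ge).antisymm
    (le_condExp_of_setIntegral_le hY hN hNm heq h.le)

/-- A process closed by an integrable random variable is a uniformly integrable martingale. -/
lemma isUIMartingale_of_condExp_eq {𝓕 : Filtration ℝ≥0 mΩ} {N : ℝ≥0 → Ω → ℝ} {Y : Ω → ℝ}
    (hY : Integrable Y P) (hN : StronglyAdapted 𝓕 N) (h : ∀ t, P[Y | 𝓕 t] =ᵐ[P] N t) :
    IsUIMartingale 𝓕 P N := by
  refine ⟨⟨hN, fun s t hst => ?_⟩, ?_⟩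
  · calc P[N t | 𝓕 s] =ᵐ[P] P[P[Y | 𝓕 t] | 𝓕 s] := condExp_congr_ae (h t).symm
      _ =ᵐ[P] P[Y | 𝓕 s] := condExp_condExp_of_le (𝓕.mono hst) (𝓕.le t)
      _ =ᵐ[P] N s := h s
  · exact (uniformIntegrable_congr_ae h).1 hY.uniformIntegrable_condExp_filtration

lemma FollowsUntil.eq_of_le (hM : FollowsUntil P γ F X M) (t : ℝ≥0) :
    ∀ᵐ ω ∂P, γ ω ≤ t → M t ω = X ω := by
  filter_upwards [hM] with ω hω h
  rw [hω t, if_neg (not_lt.2 h)]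

lemma FollowsUntil.ae_eq (hM : FollowsUntil P γ F X M) (t : ℝ≥0) :
    M t =ᵐ[P] fun ω => (γ ⁻¹' Ioi (t : ℝ≥0∞)).indicator (fun _ => F t) ω +
      (γ ⁻¹' Iic (t : ℝ≥0∞)).indicator X ω := by
  filter_upwards [hM] with ω hω
  rw [hω t]
  by_cases h : (t : ℝ≥0∞) < γ ω
  · simp [indicator, h, not_le.2 h]
  · simp [indicator, not_lt.1 h, h]

lemma FollowsUntil.integrable (hγ : Measurable γ) (hM : FollowsUntil P γ F X M) {t : ℝ≥0}
    (hX : IntegrableOn X (γ ⁻¹' Iic (t : ℝ≥0∞)) P) : Integrable (M t) P := by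
  refine Integrable.congr ?_ (hM.ae_eq t).symm
  exact ((integrable_const _).indicator (hγ measurableSet_Ioi)).add
    ((integrable_indicator_iff (hγ measurableSet_Iic)).2 hX)

lemma FollowsUntil.setIntegral [IsProbabilityMeasure (P.map γ)] (hγ : Measurable γ)
    (hM : FollowsUntil P γ F X M) {s t : ℝ≥0} (hst : s ≤ t)
    (hX : IntegrableOn X (γ ⁻¹' Iic (t : ℝ≥0∞)) P) :
    ∫ ω in {ω | (s : ℝ≥0∞) < γ ω}, M t ω ∂P =
      F t * tailG (P.map γ) t + ∫ ω in γ ⁻¹' Ioc (s : ℝ≥0∞) t, X ω ∂P := by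
  have h1 : {ω | (s : ℝ≥0∞) < γ ω} ∩ γ ⁻¹' Ioi (t : ℝ≥0∞) = γ ⁻¹' Ioi (t : ℝ≥0∞) :=
    inter_eq_right.2 fun ω hω => lt_of_le_of_lt (ENNReal.coe_le_coe.2 hst) hω
  have h2 : {ω | (s : ℝ≥0∞) < γ ω} ∩ γ ⁻¹' Iic (t : ℝ≥0∞) = γ ⁻¹' Ioc (s : ℝ≥0∞) t := rfl
  rw [integral_congr_ae (ae_restrict_of_ae (hM.ae_eq t)), integral_add
    ((integrable_const _).indicator (hγ measurableSet_Ioi))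
    ((integrable_indicator_iff (hγ measurableSet_Iic)).2 hX).integrableOn,
    setIntegral_indicator (hγ measurableSet_Ioi), setIntegral_indicator (hγ measurableSet_Iic),
    h1, h2, setIntegral_const, smul_eq_mul, tailG_eq, map_measureReal_apply hγ measurableSet_Ioi,
    mul_comm]

section

variable [IsProbabilityMeasure (P.map γ)]

lemma setIntegral_jumpValue (hγ : Measurable γ) (hHm : AEStronglyMeasurable H (dG (P.map γ)))
    {s : Set ℝ≥0} {A : Set ℝ≥0∞} (hs : MeasurableSet s) (hA : MeasurableSet A)
    (hAs : {ω | γ ω < ∞ ∧ (γ ω).toNNReal ∈ s} = γ ⁻¹' A)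
    (hH : IntegrableOn H s (dG (P.map γ))) (hL : CondExpZero P γ L')
    (hLi : IntegrableOn L' (γ ⁻¹' A) P) :
    ∫ ω in γ ⁻¹' A, jumpValue γ H L' ω ∂P = ∫ x in s, H x ∂(dG (P.map γ)) := by
  rw [setIntegral_dG_map hγ hs hHm, hAs]
  have h1 := (integrableOn_dG_map hγ hs hHm).1 hH
  rw [hAs] at h1
  have h2 := integral_add h1 hLi
  rw [hL.setIntegral_eq_zero hγ hA hLi, add_zero] at h2
  exact h2

end

end

section

/-! ### Finite jump time -/

variable {Ω : Type*} [mΩ : MeasurableSpace Ω] {P : Measure Ω} [IsProbabilityMeasure P]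
  {γ : Ω → ℝ≥0∞} {X L' : Ω → ℝ} {M : ℝ≥0 → Ω → ℝ} {F H z : ℝ≥0 → ℝ} {l : ℝ}

/-! ### The defect l decides the martingale property -/

section Closed

variable [IsProbabilityMeasure (P.map γ)]

open Classical in
-- On {s < γ} the mean of M_t exceeds that of X by l as long as t < t_G. From t_G on, {t < γ} is
-- null and the defect is gone.
lemma FollowsUntil.setIntegral_eq (hγ : Measurable γ) (hM : FollowsUntil P γ F X M)
    (hX : Integrable X P)
    (hl : ∀ t ∈ beforeEnd (P.map γ), F t * tailG (P.map γ) t =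
      l + ∫ ω in {ω | (t : ℝ≥0∞) < γ ω}, X ω ∂P) {s t : ℝ≥0} (hst : s ≤ t) :
    ∫ ω in {ω | (s : ℝ≥0∞) < γ ω}, M t ω ∂P =
      ∫ ω in {ω | (s : ℝ≥0∞) < γ ω}, X ω ∂P + if t ∈ beforeEnd (P.map γ) then l else 0 := by
  have hst' : (s : ℝ≥0∞) ≤ t := ENNReal.coe_le_coe.2 hst
  have h1 : F t * tailG (P.map γ) t = ∫ ω in {ω | (t : ℝ≥0∞) < γ ω}, X ω ∂P +
      if t ∈ beforeEnd (P.map γ) then l else 0 := by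
    split_ifs with h
    · rw [hl t h, add_comm]
    · have h2 := measure_Ioi_eq_zero _ h
      have h3 : tailG (P.map γ) t = 0 := by rw [tailG_eq, Measure.real, h2, ENNReal.toReal_zero]
      rw [Measure.map_apply hγ measurableSet_Ioi] at h2
      rw [h3, show {ω | (t : ℝ≥0∞) < γ ω} = γ ⁻¹' Ioi (t : ℝ≥0∞) from rfl,
        setIntegral_measure_zero _ h2]
      simp
  have h4 : {ω | (s : ℝ≥0∞) < γ ω} = γ ⁻¹' Ioc (s : ℝ≥0∞) t ∪ {ω | (t : ℝ≥0∞) < γ ω} := by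
    change γ ⁻¹' Ioi (s : ℝ≥0∞) = _
    rw [← Ioc_union_Ioi_eq_Ioi hst', preimage_union]
    rfl
  have h5 : Disjoint (γ ⁻¹' Ioc (s : ℝ≥0∞) t) {ω | (t : ℝ≥0∞) < γ ω} :=
    disjoint_left.2 fun ω h h' => absurd h.2 (not_le.2 h')
  rw [hM.setIntegral hγ hst hX.integrableOn, h1]
  rw [h4]
  rw [setIntegral_union h5 (hγ measurableSet_Ioi) hX.integrableOn hX.integrableOn]
  ring

/-- Between s and t, or between t and ∞, the defect on the atom either stays the same or drops from
l to 0, which is a decrease when l ≥ 0. -/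
lemma isClosedSupermartingale (hγ : Measurable γ) (hM : FollowsUntil P γ F X M)
    (hX : Integrable X P) (hadp : StronglyAdapted (singleJumpFiltration γ) M)
    (hl : ∀ t ∈ beforeEnd (P.map γ), F t * tailG (P.map γ) t =
      l + ∫ ω in {ω | (t : ℝ≥0∞) < γ ω}, X ω ∂P)
    (hlim : HasLimit P M) (hterm : terminal M =ᵐ[P] X) (hl0 : 0 ≤ l) :
    IsClosedSupermartingale (singleJumpFiltration γ) P M := by
  have hint : ∀ t, Integrable (M t) P := fun t => hM.integrable hγ hX.integrableOn
  refine ⟨⟨hadp, fun s t hst => ?_, hint⟩, hlim, hX.congr hterm.symm, fun t => ?_⟩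
  · refine condExp_le_of_setIntegral_le (hint t) (hint s) (hadp s) ?_ ?_
    · filter_upwards [hM.eq_of_le s, hM.eq_of_le t] with ω h1 h2 h
      rw [h1 h, h2 (h.trans (ENNReal.coe_le_coe.2 hst))]
    · rw [hM.setIntegral_eq hγ hX hl hst, hM.setIntegral_eq hγ hX hl le_rfl]
      by_cases ht : t ∈ beforeEnd (P.map γ)
      · simp [ht, mem_beforeEnd_of_le _ hst ht]
      · split_ifs <;> simp [hl0]
  · refine condExp_le_of_setIntegral_le (hX.congr hterm.symm) (hint t) (hadp t) ?_ ?_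
    · filter_upwards [hM.eq_of_le t, hterm] with ω h1 h2 h
      rw [h1 h, h2]
    · rw [integral_congr_ae (ae_restrict_of_ae hterm), hM.setIntegral_eq hγ hX hl le_rfl]
      split_ifs <;> simp [hl0]

lemma isClosedSubmartingale (hγ : Measurable γ) (hM : FollowsUntil P γ F X M)
    (hX : Integrable X P) (hadp : StronglyAdapted (singleJumpFiltration γ) M)
    (hl : ∀ t ∈ beforeEnd (P.map γ), F t * tailG (P.map γ) t =
      l + ∫ ω in {ω | (t : ℝ≥0∞) < γ ω}, X ω ∂P)
    (hlim : HasLimit P M) (hterm : terminal M =ᵐ[P] X) (hl0 : l ≤ 0) :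
    IsClosedSubmartingale (singleJumpFiltration γ) P M := by
  have hint : ∀ t, Integrable (M t) P := fun t => hM.integrable hγ hX.integrableOn
  refine ⟨⟨hadp, fun s t hst => ?_, hint⟩, hlim, hX.congr hterm.symm, fun t => ?_⟩
  · refine le_condExp_of_setIntegral_le (hint t) (hint s) (hadp s) ?_ ?_
    · filter_upwards [hM.eq_of_le s, hM.eq_of_le t] with ω h1 h2 h
      rw [h1 h, h2 (h.trans (ENNReal.coe_le_coe.2 hst))]
    · rw [hM.setIntegral_eq hγ hX hl hst, hM.setIntegral_eq hγ hX hl le_rfl]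
      by_cases ht : t ∈ beforeEnd (P.map γ)
      · simp [ht, mem_beforeEnd_of_le _ hst ht]
      · split_ifs <;> simp [hl0]
  · refine le_condExp_of_setIntegral_le (hX.congr hterm.symm) (hint t) (hadp t) ?_ ?_
    · filter_upwards [hM.eq_of_le t, hterm] with ω h1 h2 h
      rw [h1 h, h2]
    · rw [integral_congr_ae (ae_restrict_of_ae hterm), hM.setIntegral_eq hγ hX hl le_rfl]
      split_ifs <;> simp [hl0]

lemma isUIMartingale (hγ : Measurable γ) (hM : FollowsUntil P γ F X M)
    (hX : Integrable X P) (hadp : StronglyAdapted (singleJumpFiltration γ) M)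
    (hl : ∀ t ∈ beforeEnd (P.map γ), F t * tailG (P.map γ) t =
      0 + ∫ ω in {ω | (t : ℝ≥0∞) < γ ω}, X ω ∂P) :
    IsUIMartingale (singleJumpFiltration γ) P M := by
  refine isUIMartingale_of_condExp_eq hX hadp fun t => ?_
  refine condExp_eq_of_setIntegral_eq hX (hM.integrable hγ hX.integrableOn) (hadp t)
    (hM.eq_of_le t) ?_
  rw [hM.setIntegral_eq hγ hX hl le_rfl]
  simp

/-- Time 0 precedes t_G, so the full defect is present; on {γ = 0} already M_0 = X. -/
lemma integral_zero_eq (hγ : Measurable γ) (h0 : 0 < (P.map γ) (Ioi 0))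
    (hM : FollowsUntil P γ F X M) (hX : Integrable X P)
    (hl : ∀ t ∈ beforeEnd (P.map γ), F t * tailG (P.map γ) t =
      l + ∫ ω in {ω | (t : ℝ≥0∞) < γ ω}, X ω ∂P) :
    ∫ ω, M 0 ω ∂P = ∫ ω, X ω ∂P + l := by
  have hms : MeasurableSet {ω | ((0 : ℝ≥0) : ℝ≥0∞) < γ ω} := hγ measurableSet_Ioi
  have hint : Integrable (M 0) P := hM.integrable hγ hX.integrableOn
  have hmem : (0 : ℝ≥0) ∈ beforeEnd (P.map γ) := endpoint_pos h0
  have e1 : ∫ ω in {ω | ((0 : ℝ≥0) : ℝ≥0∞) < γ ω}ᶜ, M 0 ω ∂P =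
      ∫ ω in {ω | ((0 : ℝ≥0) : ℝ≥0∞) < γ ω}ᶜ, X ω ∂P := by
    refine integral_congr_ae ((ae_restrict_iff' hms.compl).2 ?_)
    filter_upwards [hM.eq_of_le 0] with ω h1 h
    exact h1 (not_lt.1 h)
  rw [← integral_add_compl hms hint, ← integral_add_compl hms hX, e1,
    hM.setIntegral_eq hγ hX hl le_rfl, if_pos hmem]
  ring

/-- Vitali convergence along integer times. Together with `integral_zero_eq` it forces l = 0 for
type 3. -/
lemma integral_zero_eq_of_isUIMartingale {𝓕 : Filtration ℝ≥0 mΩ} (h : IsUIMartingale 𝓕 P M)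
    (hX : Integrable X P) (hlim : ∀ᵐ ω ∂P, Tendsto (fun t => M t ω) atTop (𝓝 (X ω))) :
    ∫ ω, M 0 ω ∂P = ∫ ω, X ω ∂P := by
  have hui : UnifIntegrable (fun n : ℕ => M (n : ℝ≥0)) 1 P := by
    intro ε hε
    obtain ⟨δ, hδ, h2⟩ := h.2.2.1 hε
    exact ⟨δ, hδ, fun n => h2 _⟩
  have h1 := tendsto_Lp_finite_of_tendsto_ae le_rfl ENNReal.one_ne_top
    (fun n : ℕ => (h.1.integrable (n : ℝ≥0)).aestronglyMeasurable) (memLp_one_iff_integrable.2 hX)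
    hui (hlim.mono fun ω hω => hω.comp tendsto_natCast_atTop_atTop)
  have h2 := tendsto_integral_of_L1' X hX.aestronglyMeasurable
    (Eventually.of_forall fun n : ℕ => h.1.integrable (n : ℝ≥0)) h1
  have h3 : ∀ n : ℕ, ∫ ω, M (n : ℝ≥0) ω ∂P = ∫ ω, M 0 ω ∂P := fun n => by
    have := h.1.setIntegral_eq (zero_le : (0 : ℝ≥0) ≤ n) MeasurableSet.univ
    simpa using this.symm
  exact tendsto_nhds_unique (tendsto_const_nhds.congr fun n => (h3 n).symm) h2

end Closed

/-- Types 2a and 2b are read off the sign of l. For types 3 and 4, the conditions E Var(M)_∞ < ∞, E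
sup|M| < ∞ and ∫ Ḡ|z| dG < ∞ imply one another in a cycle. -/
lemma types_of_finite [IsProbabilityMeasure (P.map γ)] (hγ : Measurable γ)
    (h0 : 0 < (P.map γ) (Ioi 0)) (hM : IsRepresentedLocalMartingale P γ F H L' M)
    (hA : CaseA (P.map γ)) (hfin : P {ω | γ ω = ∞} = 0) (hL : ∫⁻ ω, ‖L' ω‖ₑ ∂P < ∞)
    (hH : ∫⁻ s in beforeEnd (P.map γ), ‖H s‖ₑ ∂(dG (P.map γ)) < ∞)
    (hz : IsDensity (P.map γ) F z) :
    ∃ l : ℝ, Tendsto (fun t => F t * tailG (P.map γ) t) (toEnd (P.map γ)) (𝓝 l) ∧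
      (HasType (singleJumpFiltration γ) P M .type2a ↔ 0 < l) ∧
      (HasType (singleJumpFiltration γ) P M .type2b ↔ l < 0) ∧
      (HasType (singleJumpFiltration γ) P M .type3 ↔
        (l = 0 ∧ ∫⁻ s in beforeEnd (P.map γ),
          ENNReal.ofReal (tailG (P.map γ) s * |z s|) ∂(dG (P.map γ)) = ∞)) ∧
      (HasType (singleJumpFiltration γ) P M .type4 ↔
        ∫⁻ s in beforeEnd (P.map γ),
          ENNReal.ofReal (tailG (P.map γ) s * |z s|) ∂(dG (P.map γ)) < ∞) := by
  have hfol := hM.followsUntil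
  have hHl := hM.conditionM.memL1loc
  have hmain : MainEq (P.map γ) F H := hM.conditionM.main
  have hadp := hM.localMartingale.adapted
  have hHm := hHl.aestronglyMeasurable_dG h0 hA
  have hH' : ∫⁻ s, ‖H s‖ₑ ∂(dG (P.map γ)) < ∞ := by rwa [restrict_beforeEnd _ hA] at hH
  have hHi : Integrable H (dG (P.map γ)) := ⟨hHm, hH'⟩
  have hLi : Integrable L' P := ⟨hM.measurable_L'.aestronglyMeasurable, hL⟩
  have hae : ∀ᵐ ω ∂P, γ ω < ∞ := by
    filter_upwards [measure_eq_zero_iff_ae_notMem.1 hfin] with ω hω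
    exact lt_top_iff_ne_top.2 hω
  set X := jumpValue γ H L' with hXdef
  have hXi' := integrableOn_jumpValue hγ hHm hH' hM.measurable_L'
    ((setLIntegral_le_lintegral _ _).trans_lt hL)
  have hX : Integrable X P := by
    rwa [IntegrableOn, Measure.restrict_eq_self_of_ae_mem (s := {ω | γ ω < ∞}) hae] at hXi'
  have hlim : ∀ᵐ ω ∂P, Tendsto (fun t => M t ω) atTop (𝓝 (X ω)) := by
    filter_upwards [hfol.tendsto, hae] with ω h1 h2 using h1 h2
  have hterm : terminal M =ᵐ[P] X := by
    filter_upwards [hfol.terminal_eq, hae] with ω h1 h2 using h1 h2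
  have hHas : HasLimit P M := hlim.mono fun ω hω => ⟨_, hω⟩
  set l := F 0 * tailG (P.map γ) 0 -
    ∫ s in beforeEnd (P.map γ) ∩ Ioi 0, H s ∂(dG (P.map γ)) with hl
  have hXIoi : ∫ ω in γ ⁻¹' Ioi 0, X ω ∂P =
      ∫ s in beforeEnd (P.map γ) ∩ Ioi 0, H s ∂(dG (P.map γ)) := by
    rw [inter_comm, ← Measure.restrict_restrict measurableSet_Ioi, restrict_beforeEnd _ hA,
      -- The event on the dG side is 0 < γ < ∞; excluding the null set {γ = ∞} makes the two
      -- descriptions agree exactly.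
      ← setIntegral_jumpValue (A := Ioo 0 ∞) hγ hHm measurableSet_Ioi measurableSet_Ioo ?_
      hHi.integrableOn hM.condExpZero_L' hLi.integrableOn]
    · refine setIntegral_congr_set ?_
      filter_upwards [hae] with ω hω
      exact propext ⟨fun h => ⟨h, hω⟩, fun h => h.1⟩
    · ext ω
      constructor
      · rintro ⟨h1, h2⟩
        exact ⟨(ENNReal.toNNReal_pos_iff.1 h2).1, h1⟩
      · rintro ⟨h1, h2⟩
        exact ⟨h2, ENNReal.toNNReal_pos h1.ne' h2.ne⟩
  have hlt : ∀ t ∈ beforeEnd (P.map γ), F t * tailG (P.map γ) t =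
      l + ∫ ω in {ω | (t : ℝ≥0∞) < γ ω}, X ω ∂P := by
    intro t ht
    have e1 := hmain t ht
    have e2 := setIntegral_jumpValue hγ hHm measurableSet_Ioc measurableSet_Ioc
      (setOf_toNNReal_mem_Ioc 0 t) hHi.integrableOn hM.condExpZero_L' hLi.integrableOn
    have e3 : γ ⁻¹' Ioi 0 = γ ⁻¹' Ioc ((0 : ℝ≥0) : ℝ≥0∞) t ∪ γ ⁻¹' Ioi (t : ℝ≥0∞) := by
      rw [← preimage_union, Ioc_union_Ioi_eq_Ioi (by simp)]
      simp
    have e4 : Disjoint (γ ⁻¹' Ioc ((0 : ℝ≥0) : ℝ≥0∞) t) (γ ⁻¹' Ioi (t : ℝ≥0∞)) :=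
      disjoint_left.2 fun ω h h' => absurd h.2 (not_le.2 h')
    rw [← hXIoi, e3, setIntegral_union e4 (hγ measurableSet_Ioi) hX.integrableOn
      hX.integrableOn, e2] at hl
    change _ = l + ∫ ω in γ ⁻¹' Ioi (t : ℝ≥0∞), X ω ∂P
    linarith
  have hE := integral_zero_eq hγ h0 hfol hX hlt
  have hEt : ∫ ω, terminal M ω ∂P = ∫ ω, X ω ∂P := integral_congr_ae hterm
  have h4 : ∫⁻ s in beforeEnd (P.map γ),
      ENNReal.ofReal (tailG (P.map γ) s * |z s|) ∂(dG (P.map γ)) < ∞ →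
      HasType (singleJumpFiltration γ) P M .type4 :=
    lintegral_totalVar_lt_top hγ h0 hfol hz hXi'
  have hsup : ∫⁻ ω, (⨆ t, ‖M t ω‖ₑ) ∂P < ∞ → ∫⁻ s in beforeEnd (P.map γ),
      ENNReal.ofReal (tailG (P.map γ) s * |z s|) ∂(dG (P.map γ)) < ∞ := fun h =>
    lintegral_tailG_lt_top h0 hz hHl hmain hH (lintegral_leftValue_lt_top hγ h0 hfol hz hHl hmain h)
  have hvar : HasType (singleJumpFiltration γ) P M .type4 → ∫⁻ ω, (⨆ t, ‖M t ω‖ₑ) ∂P < ∞ :=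
    fun h => (lintegral_mono fun ω => iSup_le fun t => enorm_le_totalVar t ω).trans_lt h
  refine ⟨l, hmain.tendsto hHi.integrableOn, ⟨fun h => ?_, fun h => ?_⟩,
    ⟨fun h => ?_, fun h => ?_⟩, ⟨fun h => ?_, fun h => ?_⟩, fun h => hsup (hvar h), h4⟩
  · have := h.2
    linarith
  · exact ⟨isClosedSupermartingale hγ hfol hX hadp hlt hHas hterm h.le, by linarith⟩
  · have := h.2
    linarith
  · exact ⟨isClosedSubmartingale hγ hfol hX hadp hlt hHas hterm h.le, by linarith⟩
  · refine ⟨?_, ?_⟩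
    · have := integral_zero_eq_of_isUIMartingale h.1 hX hlim
      linarith
    · by_contra hc
      exact absurd h.2 (hvar (h4 (lt_top_iff_ne_top.2 hc))).ne
  · refine ⟨isUIMartingale hγ hfol hX hadp (by rwa [h.1] at hlt), ?_⟩
    by_contra hc
    exact absurd h.2 (hsup (lt_top_iff_ne_top.2 hc)).ne

end

section

/-! ### Construction of local martingales -/

section Construction

variable {Ω : Type*} [mΩ : MeasurableSpace Ω] {P : Measure Ω} [IsProbabilityMeasure P]
  {γ : Ω → ℝ≥0∞} {X L' : Ω → ℝ} {F H z : ℝ≥0 → ℝ}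

open Classical in
/-- The process that follows `F` before `γ` and is equal to `X` afterwards. -/
noncomputable def jumpProcess (γ : Ω → ℝ≥0∞) (F : ℝ≥0 → ℝ) (X : Ω → ℝ) (t : ℝ≥0) (ω : Ω) : ℝ :=
  if (t : ℝ≥0∞) < γ ω then F t else X ω

lemma followsUntil_jumpProcess : FollowsUntil P γ F X (jumpProcess γ F X) :=
  Eventually.of_forall fun ω t => by simp only [jumpProcess]

/-- On {t < γ} the process equals the constant F(t), so a preimage contains this event or misses it.
-/
lemma stronglyAdapted_jumpProcess (hγ : Measurable γ) (hX : Measurable X) :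
    StronglyAdapted (singleJumpFiltration γ) (jumpProcess γ F X) := by
  intro t
  suffices h : Measurable[singleJumpFiltration γ t] (jumpProcess γ F X t) from h.stronglyMeasurable
  have hm : Measurable (jumpProcess γ F X t) :=
    Measurable.ite (hγ measurableSet_Ioi) measurable_const hX
  intro B hB
  refine measurableSet_singleJump.2 ⟨hm hB, ?_⟩
  have key : ∀ ω, (t : ℝ≥0∞) < γ ω → (ω ∈ jumpProcess γ F X t ⁻¹' B ↔ F t ∈ B) := by
    intro ω hω
    simp [jumpProcess, hω]
  by_cases hF : F t ∈ B
  · right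
    exact inter_eq_right.2 fun ω hω => (key ω hω).2 hF
  · left
    ext ω
    simp only [mem_inter_iff, mem_empty_iff_false, iff_false, not_and]
    exact fun h hω => hF ((key ω hω).1 h)

open Classical in
/-- The time `n` on the event that the jump is later than `n`, and `∞` otherwise. -/
noncomputable def localizer (γ : Ω → ℝ≥0∞) (n : ℕ) (ω : Ω) : WithTop ℝ≥0 :=
  if γ ω ≤ (n : ℝ≥0) then ⊤ else ((n : ℝ≥0) : WithTop ℝ≥0)

/-- If n ≤ t, then {t < γ} lies inside {n < γ}, the event where the time is at most t; if n > t,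
that event is empty. As γ is finite, the times equal ∞ from some n on. -/
lemma isLocalizingSequence_localizer (hγ : Measurable γ) (hfin : ∀ ω, γ ω < ∞) :
    IsLocalizingSequence (singleJumpFiltration γ) (localizer γ) P := by
  refine ⟨⟨fun n t => measurableSet_singleJump.2 ?_, Eventually.of_forall fun ω => ?_⟩,
    Eventually.of_forall fun ω m n hmn => ?_⟩
  · have h1 : {ω | localizer γ n ω ≤ (t : WithTop ℝ≥0)} =
        {ω | ((n : ℝ≥0) : ℝ≥0∞) < γ ω ∧ (n : ℝ≥0) ≤ t} := by
      ext ω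
      by_cases h : γ ω ≤ (n : ℝ≥0)
      · simp only [mem_ofPred_eq, localizer, if_pos h, not_lt.2 h, false_and, iff_false]
        exact (WithTop.coe_lt_top t).not_ge
      · simp only [mem_ofPred_eq, localizer, if_neg h, not_le.1 h, true_and, WithTop.coe_le_coe]
    rw [h1]
    refine ⟨(hγ measurableSet_Ioi).inter (MeasurableSet.const _), ?_⟩
    by_cases h : (n : ℝ≥0) ≤ t
    · right
      refine inter_eq_right.2 fun ω hω => ⟨lt_of_le_of_lt (ENNReal.coe_le_coe.2 h) hω, h⟩
    · left
      ext ω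
      simp [h]
  · refine tendsto_const_nhds.congr' ?_
    obtain ⟨k, hk⟩ := exists_nat_ge (γ ω).toNNReal
    filter_upwards [eventually_ge_atTop k] with n hn
    have : γ ω ≤ (n : ℝ≥0) := by
      rw [← ENNReal.coe_toNNReal (hfin ω).ne]
      exact ENNReal.coe_le_coe.2 (hk.trans (by exact_mod_cast hn))
    simp only [localizer, if_pos this]
  · have hmn' : (m : ℝ≥0) ≤ n := by exact_mod_cast hmn
    simp only [localizer]
    by_cases h : γ ω ≤ (m : ℝ≥0)
    · rw [if_pos h, if_pos (h.trans (ENNReal.coe_le_coe.2 hmn'))]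
    · rw [if_neg h]
      split_ifs
      · exact le_top
      · exact WithTop.coe_le_coe.2 hmn'

/-- Where γ ≤ n the path is constant after n, so never stopping it amounts to stopping at n. -/
lemma stoppedProcess_localizer (n : ℕ) :
    stoppedProcess (jumpProcess γ F X) (localizer γ n) =
      fun t => jumpProcess γ F X (min t (n : ℝ≥0)) := by
  ext t ω
  by_cases h : γ ω ≤ (n : ℝ≥0)
  · have h1 : stoppedProcess (jumpProcess γ F X) (localizer γ n) t ω = jumpProcess γ F X t ω := by
      simp only [stoppedProcess, localizer, if_pos h]
      rw [min_eq_left le_top]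
      rfl
    rw [h1]
    rcases le_total t (n : ℝ≥0) with ht | ht
    · rw [min_eq_left ht]
    · rw [min_eq_right ht]
      simp only [jumpProcess, if_neg (not_lt.2 h),
        if_neg (not_lt.2 (h.trans (ENNReal.coe_le_coe.2 ht)))]
  · simp only [stoppedProcess, localizer, if_neg h]
    rw [← WithTop.coe_min]
    rfl

variable [IsProbabilityMeasure (P.map γ)]

/-- The process stopped at n is closed by its value at n: `hmain` is the equality of means on {t <
γ}, the only condition to be checked for t ≤ n. -/
lemma isLocalMartingale_jumpProcess (hγ : Measurable γ) (hfin : ∀ ω, γ ω < ∞)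
    (hX : Measurable X) (hint : ∀ t : ℝ≥0, IntegrableOn X (γ ⁻¹' Iic (t : ℝ≥0∞)) P)
    (hmain : ∀ s t : ℝ≥0, s ≤ t → F t * tailG (P.map γ) t +
      ∫ ω in γ ⁻¹' Ioc (s : ℝ≥0∞) t, X ω ∂P = F s * tailG (P.map γ) s)
    (hcad : AECadlag P (jumpProcess γ F X)) :
    IsLocalMartingale (singleJumpFiltration γ) P (jumpProcess γ F X) := by
  have hadp := stronglyAdapted_jumpProcess (F := F) hγ hX
  have hfol : FollowsUntil P γ F X (jumpProcess γ F X) := followsUntil_jumpProcess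
  have hi : ∀ t, Integrable (jumpProcess γ F X t) P := fun t => hfol.integrable hγ (hint t)
  refine ⟨hadp, hcad, localizer γ, isLocalizingSequence_localizer hγ hfin, fun n => ?_⟩
  rw [stoppedProcess_localizer]
  have hadp' : StronglyAdapted (singleJumpFiltration γ)
      fun t => jumpProcess γ F X (min t (n : ℝ≥0)) := fun t =>
    (hadp (min t n)).mono ((singleJumpFiltration γ).mono (min_le_left _ _))
  refine isUIMartingale_of_condExp_eq (Y := jumpProcess γ F X n) (hi _) hadp' fun t => ?_
  rcases le_total t (n : ℝ≥0) with ht | ht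
  · refine condExp_eq_of_setIntegral_eq (hi _) (hi _) (hadp' t) ?_ ?_
    · refine Eventually.of_forall fun ω hω => ?_
      simp only [min_eq_left ht, jumpProcess, if_neg (not_lt.2 hω),
        if_neg (not_lt.2 (hω.trans (ENNReal.coe_le_coe.2 ht)))]
    · rw [min_eq_left ht, hfol.setIntegral hγ le_rfl (hint t), hfol.setIntegral hγ ht (hint n),
        hmain t n ht]
      simp
  · rw [min_eq_right ht]
    refine condExp_eq_of_setIntegral_eq (hi _) (hi _) ?_ (Eventually.of_forall fun _ _ => rfl) rfl
    exact (hadp n).mono ((singleJumpFiltration γ).mono ht)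

lemma condExpZero_zero : CondExpZero P γ (fun _ => 0) := by
  have h : condLExp (MeasurableSpace.comap γ inferInstance) P (fun _ : Ω => (0 : ℝ≥0∞)) = 0 :=
    condLExp_zero P
  refine ⟨?_, ?_⟩
  · simp only [enorm_zero, h]
    simp
  · simp

end Construction

end

section

/-! ### Processes with a geometric jump time -/

/-- The geometric law with parameter `1 / 2`. -/
noncomputable def coinLaw : Measure ℕ := geometricMeasure ⟨1 / 2, by norm_num, by norm_num⟩

instance : IsProbabilityMeasure coinLaw := isProbabilityMeasure_geometricMeasure

/-- The weights of `coinLaw`. -/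
noncomputable def weight (n : ℕ) : ℝ := (1 / 2) ^ (n + 1)

lemma weight_pos (n : ℕ) : 0 < weight n := by unfold weight; positivity

lemma weight_succ (n : ℕ) : weight (n + 1) = weight n / 2 := by unfold weight; ring

lemma coinLaw_singleton (n : ℕ) : coinLaw {n} = ENNReal.ofReal (weight n) := by
  rw [coinLaw, geometricMeasure_singleton, weight]
  · congr 1
    norm_num
    ring
  · intro h
    have := congrArg Subtype.val h
    norm_num at this

lemma coinLaw_real_singleton (n : ℕ) : coinLaw.real {n} = weight n := by
  rw [Measure.real, coinLaw_singleton, ENNReal.toReal_ofReal (weight_pos n).le]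

/-- The jump time: the outcome itself. -/
noncomputable def coinTime (n : ℕ) : ℝ≥0∞ := ((n : ℝ≥0) : ℝ≥0∞)

lemma measurable_coinTime : Measurable coinTime := measurable_of_countable _

lemma toNNReal_coinTime (n : ℕ) : (coinTime n).toNNReal = n := rfl

lemma coinTime_lt_top (n : ℕ) : coinTime n < ∞ := ENNReal.coe_lt_top

lemma lt_coinTime_iff {t : ℝ≥0} {n : ℕ} : (t : ℝ≥0∞) < coinTime n ↔ ⌊t⌋₊ < n := by
  rw [coinTime, ENNReal.coe_lt_coe, Nat.floor_lt (zero_le)]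

lemma coinTime_le_iff {t : ℝ≥0} {n : ℕ} : coinTime n ≤ t ↔ n ≤ ⌊t⌋₊ := by
  rw [← not_lt, lt_coinTime_iff, not_lt]

instance : IsProbabilityMeasure (coinLaw.map coinTime) :=
  Measure.isProbabilityMeasure_map measurable_coinTime.aemeasurable

lemma tailG_coin (t : ℝ≥0) : tailG (coinLaw.map coinTime) t = weight ⌊t⌋₊ := by
  have h1 : coinTime ⁻¹' Iic (t : ℝ≥0∞) = ((Finset.range (⌊t⌋₊ + 1) : Finset ℕ) : Set ℕ) := by
    ext n
    simp only [mem_preimage, mem_Iic, coinTime_le_iff, Finset.coe_range, mem_Iio,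
      Nat.lt_succ_iff]
  have h2 : ∀ k : ℕ, ∑ n ∈ Finset.range k, weight n = 1 - (1 / 2) ^ k := by
    intro k
    induction k with
    | zero => simp
    | succ k ih => rw [Finset.sum_range_succ, ih, weight]; ring
  rw [tailG, cdfG, map_measureReal_apply measurable_coinTime measurableSet_Iic, h1,
    ← sum_measureReal_singleton]
  simp only [coinLaw_real_singleton]
  rw [h2, weight]
  ring

lemma beforeEnd_coin : beforeEnd (coinLaw.map coinTime) = univ :=
  eq_univ_of_forall fun t => (mem_beforeEnd_iff _).2 (by rw [tailG_coin]; exact weight_pos _)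

lemma caseA_coin : CaseA (coinLaw.map coinTime) := by
  have : {x : ℝ≥0∞ | x = endpoint (coinLaw.map coinTime) ∧ x < ∞} = ∅ := by
    ext x
    rw [endpoint_eq_top beforeEnd_coin]
    simp only [mem_ofPred_eq, mem_empty_iff_false, iff_false, not_and]
    rintro rfl
    simp
  rw [CaseA, this, measure_empty]

lemma coin_Ioi_pos : 0 < (coinLaw.map coinTime) (Ioi 0) := by
  have := ofReal_tailG (coinLaw.map coinTime) 0
  rw [tailG_coin] at this
  rw [← ENNReal.coe_zero, ← this]
  exact ENNReal.ofReal_pos.2 (weight_pos _)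

/-- The `dG`-density of the step function with values `a n` on `[n, n + 1)`. -/
noncomputable def stepDensity (a : ℕ → ℝ) (t : ℝ≥0) : ℝ :=
  (a ⌊t⌋₊ - a (⌊t⌋₊ - 1)) / weight ⌊t⌋₊

lemma measurable_step (a : ℕ → ℝ) : Measurable fun t : ℝ≥0 => a ⌊t⌋₊ :=
  (measurable_of_countable a).comp Nat.measurable_floor

lemma measurable_stepDensity (a : ℕ → ℝ) : Measurable (stepDensity a) :=
  measurable_step fun n => (a n - a (n - 1)) / weight n

lemma memL1loc_stepDensity (a : ℕ → ℝ) : MemL1loc (coinLaw.map coinTime) (stepDensity a) := by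
  refine ⟨(measurable_stepDensity a).comp measurable_subtype_coe, fun t _ => ?_⟩
  rw [integrableOn_dG_map measurable_coinTime measurableSet_Iic
    (measurable_stepDensity a).aestronglyMeasurable, setOf_toNNReal_mem_Iic]
  refine IntegrableOn.of_finite ((finite_Iic ⌊t⌋₊).subset fun n hn => ?_)
  exact coinTime_le_iff.1 hn

/-- The mass of each atom cancels the denominator of the density, and the increments of a telescope.
-/
lemma setIntegral_stepDensity (a : ℕ → ℝ) {s t : ℝ≥0} (hst : s ≤ t) :
    ∫ n in coinTime ⁻¹' Ioc (s : ℝ≥0∞) t, stepDensity a (coinTime n).toNNReal ∂coinLaw =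
      a ⌊t⌋₊ - a ⌊s⌋₊ := by
  have h1 : coinTime ⁻¹' Ioc (s : ℝ≥0∞) t =
      ((Finset.Ico (⌊s⌋₊ + 1) (⌊t⌋₊ + 1) : Finset ℕ) : Set ℕ) := by
    ext n
    simp only [mem_preimage, mem_Ioc, coinTime_le_iff, lt_coinTime_iff, Finset.coe_Ico, mem_Ico]
    omega
  rw [h1, setIntegral_finset _ IntegrableOn.finset, ← Finset.sum_Ico_add' _ _ _ 1]
  simp only [coinLaw_real_singleton, toNNReal_coinTime, stepDensity, Nat.floor_natCast, smul_eq_mul,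
    add_tsub_cancel_right]
  rw [← Finset.sum_Ico_sub a (Nat.floor_mono hst)]
  refine Finset.sum_congr rfl fun n _ => ?_
  have := (weight_pos (n + 1)).ne'
  field_simp

lemma setIntegral_dG_stepDensity (a : ℕ → ℝ) (t : ℝ≥0) :
    ∫ x in Ioc 0 t, stepDensity a x ∂(dG (coinLaw.map coinTime)) = a ⌊t⌋₊ - a 0 := by
  rw [setIntegral_dG_map measurable_coinTime measurableSet_Ioc
    (measurable_stepDensity a).aestronglyMeasurable, setOf_toNNReal_mem_Ioc,
    setIntegral_stepDensity a zero_le]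
  simp

lemma isDensity_step (a : ℕ → ℝ) :
    IsDensity (coinLaw.map coinTime) (fun t => a ⌊t⌋₊) (stepDensity a) := by
  refine ⟨memL1loc_stepDensity a, fun t _ => ?_⟩
  rw [setIntegral_dG_stepDensity]
  simp

lemma lintegral_dG_coin {g : ℕ → ℝ≥0∞} :
    ∫⁻ s in beforeEnd (coinLaw.map coinTime), g ⌊s⌋₊ ∂(dG (coinLaw.map coinTime)) =
      ∑' n, g n * ENNReal.ofReal (weight n) := by
  have hg : Measurable fun s : ℝ≥0 => g ⌊s⌋₊ :=
    (measurable_of_countable g).comp Nat.measurable_floor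
  rw [beforeEnd_coin, Measure.restrict_univ,
    lintegral_dG_map measurable_coinTime hg.aemeasurable]
  simp only [coinTime_lt_top, toNNReal_coinTime, Nat.floor_natCast]
  rw [show {n : ℕ | True} = univ from rfl, Measure.restrict_univ, lintegral_countable']
  simp only [coinLaw_singleton]

lemma aecadlag_jumpProcess_coin (a : ℕ → ℝ) (X : ℕ → ℝ) :
    AECadlag coinLaw (jumpProcess coinTime (fun t => a ⌊t⌋₊) X) := by
  refine Eventually.of_forall fun n t => ?_
  have hstep : (fun s => jumpProcess coinTime (fun t => a ⌊t⌋₊) X s n) =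
      fun s : ℝ≥0 => if ⌊s⌋₊ < n then a ⌊s⌋₊ else X n := by
    ext s
    by_cases h : ⌊s⌋₊ < n
    · simp only [jumpProcess, if_pos (lt_coinTime_iff.2 h), if_pos h]
    · simp only [jumpProcess, if_neg (mt lt_coinTime_iff.1 h), if_neg h]
  rw [hstep]
  set m : ℕ → ℝ := fun k => if k < n then a k else X n
  change ContinuousWithinAt (fun s : ℝ≥0 => m ⌊s⌋₊) (Ici t) t ∧
    ∃ l, Tendsto (fun s : ℝ≥0 => m ⌊s⌋₊) (𝓝[<] t) (𝓝 l)
  constructor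
  · refine tendsto_const_nhds.congr' ?_
    have h1 : ∀ᶠ s in 𝓝[≥] t, s < (⌊t⌋₊ : ℝ≥0) + 1 :=
      mem_nhdsWithin_of_mem_nhds (gt_mem_nhds (Nat.lt_floor_add_one t))
    filter_upwards [h1, self_mem_nhdsWithin] with s hs hts
    congr 1
    exact ((Nat.floor_eq_iff zero_le).2 ⟨(Nat.floor_le zero_le).trans hts, hs⟩).symm
  · rcases eq_or_ne t 0 with rfl | ht
    -- The left neighbourhood filter of 0 is trivial, so any limit will do.
    · exact ⟨0, by simp⟩
    · have hc : 0 < ⌈t⌉₊ := Nat.ceil_pos.2 (pos_iff_ne_zero.2 ht)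
      have hlt : ((⌈t⌉₊ - 1 : ℕ) : ℝ≥0) < t := Nat.lt_ceil.1 (by omega)
      -- Just to the left of t > 0 the floor is ⌈t⌉ - 1, whether or not t is an integer.
      refine ⟨m (⌈t⌉₊ - 1), tendsto_const_nhds.congr' ?_⟩
      have h1 : ∀ᶠ s in 𝓝[<] t, ((⌈t⌉₊ - 1 : ℕ) : ℝ≥0) < s :=
        mem_nhdsWithin_of_mem_nhds (lt_mem_nhds hlt)
      filter_upwards [h1, self_mem_nhdsWithin] with s hs hst
      congr 1
      refine ((Nat.floor_eq_iff zero_le).2 ⟨hs.le, lt_of_lt_of_le hst ?_⟩).symm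
      refine (Nat.le_ceil t).trans ?_
      exact_mod_cast (by omega : ⌈t⌉₊ ≤ ⌈t⌉₊ - 1 + 1)

/-- The function `F` with `F(t) (1 - G(t)) = u(n)` on `[n, n + 1)`. -/
noncomputable def coinF (u : ℕ → ℝ) (t : ℝ≥0) : ℝ := u ⌊t⌋₊ / weight ⌊t⌋₊

/-- The function `H` that is paired with `coinF u` by Condition M. -/
noncomputable def coinH (u : ℕ → ℝ) : ℝ≥0 → ℝ := stepDensity fun n => -u n

lemma coinF_mul_tailG (u : ℕ → ℝ) (t : ℝ≥0) :
    coinF u t * tailG (coinLaw.map coinTime) t = u ⌊t⌋₊ := by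
  rw [tailG_coin, coinF, div_mul_cancel₀ _ (weight_pos _).ne']

lemma isDensity_coinF (u : ℕ → ℝ) :
    IsDensity (coinLaw.map coinTime) (coinF u) (stepDensity fun n => u n / weight n) :=
  isDensity_step fun n => u n / weight n

/-- The local martingale with `F = coinF u` and `L' = 0`. -/
noncomputable def coinM (u : ℕ → ℝ) : ℝ≥0 → ℕ → ℝ :=
  jumpProcess coinTime (coinF u) (jumpValue coinTime (coinH u) fun _ => 0)

/-- No restriction on u is needed: FḠ equals u(⌊t⌋) and H integrates to minus the increments of u,
so Condition M telescopes. -/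
lemma isRepresentedLocalMartingale_coinM (u : ℕ → ℝ) :
    IsRepresentedLocalMartingale coinLaw coinTime (coinF u) (coinH u) (fun _ => 0) (coinM u) where
  localMartingale := by
    refine isLocalMartingale_jumpProcess measurable_coinTime coinTime_lt_top
      (measurable_of_countable _) (fun t => ?_) (fun s t hst => ?_)
      (aecadlag_jumpProcess_coin (fun n => u n / weight n) _)
    · exact IntegrableOn.of_finite ((finite_Iic ⌊t⌋₊).subset fun n hn => coinTime_le_iff.1 hn)
    · simp only [jumpValue, add_zero]
      rw [coinF_mul_tailG, coinF_mul_tailG, coinH, setIntegral_stepDensity _ hst]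
      ring
  conditionM :=
    { absCont := ⟨_, isDensity_coinF u⟩
      memL1loc := memL1loc_stepDensity _
      main := fun t _ => by
        rw [coinF_mul_tailG, coinF_mul_tailG, coinH, setIntegral_dG_stepDensity]
        simp
      mainB := fun h => absurd caseA_coin h.ne' }
  measurable_L' := measurable_const
  integrableOn_L' := fun _ _ => integrableOn_zero
  condExpZero_L' := condExpZero_zero
  representation := by
    refine Eventually.of_forall fun n t => ?_
    by_cases ht : (t : ℝ≥0∞) < coinTime n
    · simp [indicator, coinM, jumpProcess, ht, not_le.2 ht]
    · simp [indicator, coinM, jumpProcess, ht, not_lt.1 ht, jumpValue]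

/-- Atom masses cancel again. The term n = 0 vanishes, since 0 - 1 = 0 in ℕ. -/
lemma lintegral_coinH (u : ℕ → ℝ) :
    ∫⁻ s in beforeEnd (coinLaw.map coinTime), ‖coinH u s‖ₑ ∂(dG (coinLaw.map coinTime)) =
      ∑' n, ENNReal.ofReal |u n - u (n - 1)| := by
  have h := lintegral_dG_coin (g := fun n => ‖(-u n - -u (n - 1)) / weight n‖ₑ)
  refine h.trans (tsum_congr fun n => ?_)
  have hw := weight_pos n
  rw [Real.enorm_eq_ofReal_abs, ← ENNReal.ofReal_mul (abs_nonneg _), abs_div, abs_of_pos hw,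
    div_mul_cancel₀ _ hw.ne', ← abs_neg]
  congr 2
  ring

lemma lintegral_coin_tailG (u : ℕ → ℝ) :
    ∫⁻ s in beforeEnd (coinLaw.map coinTime), ENNReal.ofReal (tailG (coinLaw.map coinTime) s *
      |stepDensity (fun n => u n / weight n) s|) ∂(dG (coinLaw.map coinTime)) =
      ∑' n, ENNReal.ofReal (weight n * |u n / weight n - u (n - 1) / weight (n - 1)|) := by
  have h := lintegral_dG_coin (g := fun n => ENNReal.ofReal (weight n *
    |(u n / weight n - u (n - 1) / weight (n - 1)) / weight n|))
  simp only [tailG_coin]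
  refine h.trans (tsum_congr fun n => ?_)
  have hw := weight_pos n
  rw [← ENNReal.ofReal_mul (by positivity), abs_div, abs_of_pos hw]
  congr 1
  field_simp

lemma hasType1_coinM {u : ℕ → ℝ} (hu : ∑' n, ENNReal.ofReal |u n - u (n - 1)| = ∞) :
    HasType (singleJumpFiltration coinTime) coinLaw (coinM u) .type1 :=
  (hasType1_iff measurable_coinTime coin_Ioi_pos (isRepresentedLocalMartingale_coinM u)
    caseA_coin).2 (Or.inr (by rw [lintegral_coinH, hu]))

lemma types_coinM {u : ℕ → ℝ} {l : ℝ} (hu : ∑' n, ENNReal.ofReal |u n - u (n - 1)| < ∞)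
    (hl : Tendsto u atTop (𝓝 l)) :
    (HasType (singleJumpFiltration coinTime) coinLaw (coinM u) .type2a ↔ 0 < l) ∧
    (HasType (singleJumpFiltration coinTime) coinLaw (coinM u) .type2b ↔ l < 0) ∧
    (HasType (singleJumpFiltration coinTime) coinLaw (coinM u) .type3 ↔ (l = 0 ∧
      ∑' n, ENNReal.ofReal (weight n * |u n / weight n - u (n - 1) / weight (n - 1)|) = ∞)) ∧
    (HasType (singleJumpFiltration coinTime) coinLaw (coinM u) .type4 ↔
      ∑' n, ENNReal.ofReal (weight n * |u n / weight n - u (n - 1) / weight (n - 1)|) < ∞) := by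
  obtain ⟨l', hl', h⟩ := types_of_finite measurable_coinTime coin_Ioi_pos
    (isRepresentedLocalMartingale_coinM u) caseA_coin
    (by simp [(coinTime_lt_top _).ne]) (by simp) (by rwa [lintegral_coinH]) (isDensity_coinF u)
  have h1 : Tendsto (fun t : ℝ≥0 => u ⌊t⌋₊) atTop (𝓝 l') :=
    (hl'.mono_left (atTop_le_toEnd beforeEnd_coin)).congr (coinF_mul_tailG u)
  have h2 : l' = l := tendsto_nhds_unique h1 (hl.comp tendsto_nat_floor_atTop)
  rwa [lintegral_coin_tailG, h2] at h

/-- The increments telescope, with sum at most u(0). -/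
lemma tsum_antitone_lt_top {u : ℕ → ℝ} (hu : Antitone u) (h0 : ∀ n, 0 ≤ u n) :
    ∑' n, ENNReal.ofReal |u n - u (n - 1)| < ∞ := by
  have h1 : ∀ n, |u n - u (n - 1)| = u (n - 1) - u n := fun n => by
    rw [abs_sub_comm, abs_of_nonneg (sub_nonneg.2 (hu (Nat.sub_le n 1)))]
  have h2 : Summable fun n => |u n - u (n - 1)| := by
    refine summable_of_sum_range_le (c := u 0) (fun n => abs_nonneg _) fun n => ?_
    have h3 : ∑ i ∈ Finset.range n, |u i - u (i - 1)| ≤ u 0 - u (n - 1) := by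
      induction n with
      | zero => simp
      | succ n ih =>
        rw [Finset.sum_range_succ, h1 n, Nat.add_sub_cancel]
        linarith
    linarith [h0 (n - 1)]
  rw [← ENNReal.ofReal_tsum_of_nonneg (fun n => abs_nonneg _) h2]
  exact ENNReal.ofReal_lt_top

/-! ### Sequences u realizing the five types -/

lemma hasType1_coinM_cast : HasType (singleJumpFiltration coinTime) coinLaw
    (coinM fun n => (n : ℝ)) .type1 := by
  refine hasType1_coinM ?_
  refine top_unique ?_
  calc (∞ : ℝ≥0∞) = ∑' _ : ℕ, 1 := (ENNReal.tsum_const_eq_top_of_ne_zero one_ne_zero).symm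
    _ = ∑' n : ℕ, ENNReal.ofReal |((n + 1 : ℕ) : ℝ) - ((n + 1 - 1 : ℕ) : ℝ)| := by simp
    _ ≤ _ := ENNReal.tsum_comp_le_tsum_of_injective (add_left_injective 1)
      fun n : ℕ => ENNReal.ofReal |(n : ℝ) - ((n - 1 : ℕ) : ℝ)|

lemma hasType2a_coinM_one : HasType (singleJumpFiltration coinTime) coinLaw
    (coinM fun _ => 1) .type2a :=
  (types_coinM (by simp) tendsto_const_nhds).1.2 one_pos

lemma hasType2b_coinM_neg_one : HasType (singleJumpFiltration coinTime) coinLaw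
    (coinM fun _ => -1) .type2b :=
  (types_coinM (by simp) tendsto_const_nhds).2.1.2 (by norm_num)

/-- Here u is monotone with limit 0, so H is integrable and l = 0. Halving of the weights turns the
terms of ∫ Ḡ|z| dG into |u(n) - u(n-1)/2|, of order 1/(2n), and the series diverges. -/
lemma hasType3_coinM_one_div : HasType (singleJumpFiltration coinTime) coinLaw
    (coinM fun n => 1 / ((n : ℝ) + 1)) .type3 := by
  refine (types_coinM (tsum_antitone_lt_top ?_ fun n => by positivity)
    tendsto_one_div_add_atTop_nhds_zero_nat).2.2.1.2 ⟨rfl, ?_⟩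
  · intro m n h
    have : (m : ℝ) ≤ n := by exact_mod_cast h
    exact one_div_le_one_div_of_le (by positivity) (by linarith)
  · by_contra hc
    have h1 := ENNReal.summable_toReal hc
    have h2 := (summable_nat_add_iff 2).2 h1
    -- With the shift by 2 and the factor 1/4, the term minus its harmonic lower bound is n /
    -- (4(n+2)(n+3)), nonnegative for every n; a shift by 1 would fail at n = 0.
    have h3 : Summable fun n : ℕ => 1 / 4 * (1 / (((n + 3 : ℕ) : ℝ))) := by
      refine h2.of_nonneg_of_le (fun n => by positivity) fun n => ?_
      have hw := weight_pos (n + 1)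
      rw [ENNReal.toReal_ofReal (mul_nonneg (weight_pos _).le (abs_nonneg _))]
      have h5 : ∀ A B : ℝ, weight (n + 2) * |A / weight (n + 2) - B / weight (n + 2 - 1)| =
          |A - B / 2| := fun A B => by
        have e : n + 2 - 1 = n + 1 := rfl
        nth_rewrite 1 [← abs_of_pos (weight_pos (n + 2))]
        rw [← abs_mul, e, weight_succ (n + 1)]
        congr 1
        field_simp
      rw [h5]
      refine le_trans ?_ (le_abs_self _)
      have e : n + 2 - 1 = n + 1 := rfl
      rw [e]
      push_cast
      rw [← sub_nonneg]
      have h6 : 1 / ((n : ℝ) + 2 + 1) - 1 / ((n : ℝ) + 1 + 1) / 2 - 1 / 4 * (1 / ((n : ℝ) + 3)) =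
          n / (4 * (n + 2) * (n + 3)) := by
        have : (n : ℝ) + 2 + 1 = n + 3 := by ring
        rw [this, show (n : ℝ) + 1 + 1 = n + 2 by ring]
        field_simp
        ring
      rw [h6]
      positivity
    have h4 := (summable_nat_add_iff (f := fun n : ℕ => 1 / (n : ℝ)) 3).1
      ((summable_mul_left_iff (by norm_num)).1 h3)
    exact Real.not_summable_one_div_natCast h4

lemma hasType4_coinM_single : HasType (singleJumpFiltration coinTime) coinLaw
    (coinM fun n => if n = 0 then 1 else 0) .type4 := by
  refine (types_coinM (l := 0) (tsum_antitone_lt_top ?_ fun n => ?_) ?_).2.2.2.2 ?_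
  · intro m n h
    by_cases hm : m = 0
    · simp only [hm, if_true]
      split_ifs <;> norm_num
    · have : n ≠ 0 := by omega
      simp [hm, this]
  · split_ifs <;> norm_num
  · refine tendsto_const_nhds.congr' ?_
    filter_upwards [eventually_ge_atTop 1] with n hn
    rw [if_neg (by omega)]
  -- F drops to 0 at time 1 and stays there, so only n = 1 contributes.
  · rw [tsum_eq_single 1]
    · exact ENNReal.ofReal_lt_top
    · intro n hn
      rcases eq_or_ne n 0 with rfl | h0
      · simp
      · have : n - 1 ≠ 0 := by omega
        simp [h0, this]

theorem exists_hasType (k : GlobalType) :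
    ∃ (Ω : Type) (_ : MeasurableSpace Ω) (P : Measure Ω) (_ : IsProbabilityMeasure P)
      (γ : Ω → ℝ≥0∞) (F H : ℝ≥0 → ℝ) (L' : Ω → ℝ) (M : ℝ≥0 → Ω → ℝ),
      Measurable γ ∧ 0 < P {ω | 0 < γ ω} ∧ IsRepresentedLocalMartingale P γ F H L' M ∧
      CaseA (P.map γ) ∧ HasType (singleJumpFiltration γ) P M k := by
  have h0 : 0 < coinLaw {n | 0 < coinTime n} := by
    have := coin_Ioi_pos
    rwa [Measure.map_apply measurable_coinTime measurableSet_Ioi] at this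
  obtain ⟨u, hu⟩ : ∃ u, HasType (singleJumpFiltration coinTime) coinLaw (coinM u) k := by
    cases k
    exacts [⟨_, hasType1_coinM_cast⟩, ⟨_, hasType2a_coinM_one⟩, ⟨_, hasType2b_coinM_neg_one⟩,
      ⟨_, hasType3_coinM_one_div⟩, ⟨_, hasType4_coinM_single⟩]
  exact ⟨ℕ, inferInstance, coinLaw, inferInstance, coinTime, _, _, _, _, measurable_coinTime, h0,
    isRepresentedLocalMartingale_coinM u, caseA_coin, hu⟩

end

end SingleJump

/-- Classification of the local martingales of a single jump filtration by their global behaviour: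
Case B; Case A, parts (i), (ii), (iii); and the realizability in Case A of every type. -/
theorem theorem4 :
    (∀ (Ω : Type*) [MeasurableSpace Ω] (P : Measure Ω) [IsProbabilityMeasure P]
      (γ : Ω → ℝ≥0∞) (_ : Measurable γ) (_ : 0 < P {ω | 0 < γ ω})
      (F H : ℝ≥0 → ℝ) (L' : Ω → ℝ) (M : ℝ≥0 → Ω → ℝ)
      (_ : SingleJump.IsRepresentedLocalMartingale P γ F H L' M),
      (SingleJump.CaseB (P.map γ) →
        SingleJump.HasType (SingleJump.singleJumpFiltration γ) P M .type4) ∧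
      (SingleJump.CaseA (P.map γ) →
        -- (i)
        (SingleJump.HasType (SingleJump.singleJumpFiltration γ) P M .type1 ↔
          (∫⁻ ω in {ω | γ ω < ∞}, ‖L' ω‖ₑ ∂P = ∞ ∨
            ∫⁻ s in SingleJump.beforeEnd (P.map γ), ‖H s‖ₑ ∂(SingleJump.dG (P.map γ)) = ∞)) ∧
        -- (ii)
        (0 < P {ω | γ ω = ∞} →
          ∫⁻ ω in {ω | γ ω < ∞}, ‖L' ω‖ₑ ∂P < ∞ →
          ∫⁻ s, ‖H s‖ₑ ∂(SingleJump.dG (P.map γ)) < ∞ →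
          SingleJump.HasType (SingleJump.singleJumpFiltration γ) P M .type4) ∧
        -- (iii)
        (P {ω | γ ω = ∞} = 0 →
          ∫⁻ ω, ‖L' ω‖ₑ ∂P < ∞ →
          ∫⁻ s in SingleJump.beforeEnd (P.map γ), ‖H s‖ₑ ∂(SingleJump.dG (P.map γ)) < ∞ →
          ∀ z : ℝ≥0 → ℝ, SingleJump.IsDensity (P.map γ) F z →
          ∃ l : ℝ,
            Tendsto (fun t => F t * SingleJump.tailG (P.map γ) t)
              (SingleJump.toEnd (P.map γ)) (𝓝 l) ∧
            (SingleJump.HasType (SingleJump.singleJumpFiltration γ) P M .type2a ↔ 0 < l) ∧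
            (SingleJump.HasType (SingleJump.singleJumpFiltration γ) P M .type2b ↔ l < 0) ∧
            (SingleJump.HasType (SingleJump.singleJumpFiltration γ) P M .type3 ↔
              (l = 0 ∧
                ∫⁻ s in SingleJump.beforeEnd (P.map γ),
                  ENNReal.ofReal (SingleJump.tailG (P.map γ) s * |z s|)
                    ∂(SingleJump.dG (P.map γ)) = ∞)) ∧
            (SingleJump.HasType (SingleJump.singleJumpFiltration γ) P M .type4 ↔
              ∫⁻ s in SingleJump.beforeEnd (P.map γ),
                ENNReal.ofReal (SingleJump.tailG (P.map γ) s * |z s|)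
                  ∂(SingleJump.dG (P.map γ)) < ∞)))) ∧
    -- in Case A all types are possible
    (∀ k : SingleJump.GlobalType,
      ∃ (Ω : Type) (_ : MeasurableSpace Ω) (P : Measure Ω) (_ : IsProbabilityMeasure P)
        (γ : Ω → ℝ≥0∞) (F H : ℝ≥0 → ℝ) (L' : Ω → ℝ) (M : ℝ≥0 → Ω → ℝ),
        Measurable γ ∧ 0 < P {ω | 0 < γ ω} ∧
        SingleJump.IsRepresentedLocalMartingale P γ F H L' M ∧
        SingleJump.CaseA (P.map γ) ∧
        SingleJump.HasType (SingleJump.singleJumpFiltration γ) P M k) := by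
  refine ⟨?_, SingleJump.exists_hasType⟩
  intro Ω _ P _ γ hγ hpos F H L' M hM
  have : IsProbabilityMeasure (P.map γ) := Measure.isProbabilityMeasure_map hγ.aemeasurable
  have h0 : 0 < (P.map γ) (Ioi 0) := by
    rw [Measure.map_apply hγ measurableSet_Ioi]
    exact hpos
  exact ⟨SingleJump.hasType4_of_caseB hγ h0 hM, fun hA =>
    ⟨SingleJump.hasType1_iff hγ h0 hM hA, SingleJump.hasType4_of_eq_top_pos hγ h0 hM hA,
      fun hfin hL hH z hz => SingleJump.types_of_finite hγ h0 hM hA hfin hL hH hz⟩⟩
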